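/- **Setting.** Let $M,K,O,\zeta$ be integers with $K,\zeta\ge 1$, $O\ge 0$ and $\zeta=M-K-O+1$, and let $\lambda,d_0,\rho,\tau>0$, $\alpha>2$, $R_c\ge 0$. Base stations (BSs) with $M$ antennas form a homogeneous Poisson point process $\Phi$ of density $\lambda$ on $\mathbb R^2$. Each BS serves $K$ scheduled single-antenna users and nulls its interference at $O$ out-of-cell users, by zero-forcing (ZF) beamforming with equal power per beam: with $g_l$ the channel to the $l$-th of these $K+O$ users and $\hat g_l=g_l/\|g_l\|$, the beam of user $l$ is $w_l=u_l/\|u_l\|$, $u_l=(I-G_{-l}(G_{-l}^{\sf H}G_{-l})^{-1}G_{-l}^{\sf H})\hat g_l$, where $G_{-l}$ has the columns $\hat g_{l'}$, $l'\ne l$. The path loss at distance $r$ is $\beta(r)=(1+r/d_0)^{-\alpha}$, and small-scale fading vectors are $\mathcal{CN}(0,I_M)$. Consider a typical scheduled user at the origin. Under the simplifying analytical assumptions (its cluster, the disc of radius $R_c$, contributes no interference and is statistically independent of the BSs outside it), its signal-to-interference-plus-noise ratio is $$\gamma=\frac{\rho\,\beta(r_0)\,|h_0^{\sf H}w_0|^2}{1+\sum_{m\in\Phi_I}\sum_{k=1}^K\rho\,\beta(\|x_m\|)\,|h_m^{\sf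 H}w_{k,m}|^2},$$ where: - $\Phi_I$ is the set of BSs of $\Phi$ at distance greater than $R_c$, BS $m$ being located at $x_m$; - the distance $r_0$ to the serving BS has the law of the distance from the origin to the closest point of $\Phi$, i.e. $F(r)=1-e^{-\lambda\pi r^2}$, $r>0$, and is independent of $\Phi_I$; - the fading vectors from the serving BS to its $K+O$ users are i.i.d. $\mathcal{CN}(0,I_M)$ and independent of $(r_0,\Phi)$; $h_0$ is the one of the typical user, and $w_0$ is its ZF beam; - the fading vectors $h_m$ from the other BSs to the typical user are i.i.d. $\mathcal{CN}(0,I_M)$ and independent of all the above and of the channels that determine the beams $w_{k,m}$; - $w_{1,m},\dots,w_{K,m}$ are the ZF beams of BS $m$ for its scheduled users, and almost surely, at every interfering BS, the $K+O$ channels are linearly independent and the scheduled users have orthogonal channels (after projection onto the orthogonal complement of the span of the $O$ nulled channels). **Theorem.** Almost surely the interference sum converges, $\log(1+\gamma/\tau)$ is integrable, and the per-BS ergodic sum rate $R_{cell}=K\,\mathbb E[\log(1+\gamma/\tau)]$ (natural logarithm; nats/sec/Hz) equals the convergent integral $$R_{cell}=K\int_0^\infty\frac{e^{-z\tau}}{z}\,\exp\bigl(2\pi\lambda(\Psi_{\mathrm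 I}(z\tau)-\Psi_{\mathrm{II}}(z\tau))\bigr)\Bigl(1-\int_0^\infty F'(r)\,\bigl(1+z\rho(1+\tfrac r{d_0})^{-\alpha}\bigr)^{-\zeta}\,dr\Bigr)dz,$$ where, with ${}_2F_1$ the Gauss hypergeometric function (analytically continued to the negative real axis), $$\Psi_{\mathrm I}(s)=\tfrac{d_0^2}{2}\bigl(1+\tfrac{R_c}{d_0}\bigr)^2\Bigl(1-{}_2F_1\bigl(K,-\tfrac2\alpha;1-\tfrac2\alpha;-s\rho(1+\tfrac{R_c}{d_0})^{-\alpha}\bigr)\Bigr),$$ $$\Psi_{\mathrm{II}}(s)=d_0^2\bigl(1+\tfrac{R_c}{d_0}\bigr)\Bigl(1-{}_2F_1\bigl(K,-\tfrac1\alpha;1-\tfrac1\alpha;-s\rho(1+\tfrac{R_c}{d_0})^{-\alpha}\bigr)\Bigr).$$ -/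

import Mathlib

open MeasureTheory ProbabilityTheory

noncomputable section

/-- The location space of base stations (BSs): the Euclidean plane. -/
abbrev Plane : Type := EuclideanSpace ℝ (Fin 2)

/-- Channel and beam vectors for a BS with `M` antennas, with the `ℓ²` norm and
`inner ℂ h w = hᴴ w`. -/
abbrev AntennaVec (M : ℕ) : Type := EuclideanSpace ℂ (Fin M)

/-! ### Point processes -/

/-- The random counting measure `∑ₙ δ_{Xₙ}` of a random sequence of points. -/
def countingMeasure {Ω E : Type*} [MeasurableSpace E] (X : ℕ → Ω → E) (ω : Ω) : Measure E :=
  Measure.sum fun n => Measure.dirac (X n ω)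

/-- The random points `X 0, X 1, …` enumerate a Poisson point process with intensity measure `ν`:
the number of points in a measurable set of finite intensity is Poisson distributed, and the
numbers of points in disjoint measurable sets are independent. -/
structure IsPoissonPointProcess {Ω E : Type*} [MeasurableSpace Ω] [MeasurableSpace E]
    (P : Measure Ω) (X : ℕ → Ω → E) (ν : Measure E) : Prop where
  measurable : ∀ n, Measurable (X n)
  poisson : ∀ A : Set E, MeasurableSet A → ν A < ⊤ →
    P.map (fun ω => countingMeasure X ω A) =
      (poissonMeasure (ν A).toNNReal).map (fun k : ℕ => (k : ENNReal))
  indep : ∀ (n : ℕ) (A : Fin n → Set E), (∀ i, MeasurableSet (A i)) →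
    Pairwise (fun i j => Disjoint (A i) (A j)) →
    iIndepFun (fun i ω => countingMeasure X ω (A i)) P

/-- Homogeneous Poisson point process of density `lam` on the plane. -/
def IsHomogeneousPPP {Ω : Type*} [MeasurableSpace Ω] (P : Measure Ω) (X : ℕ → Ω → Plane)
    (lam : ℝ) : Prop :=
  IsPoissonPointProcess P X (ENNReal.ofReal lam • (volume : Measure Plane))

/-- Distance from the user, placed at the origin, to the closest point of the process. -/
def nearestDistance {Ω : Type*} (X : ℕ → Ω → Plane) (ω : Ω) : ℝ := ⨅ n, ‖X n ω‖

/-- The process `Φ_I` of the points outside the cluster disc of radius `Rc` around the user. -/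
def outsideProcess {Ω : Type*} (X : ℕ → Ω → Plane) (Rc : ℝ) (ω : Ω) : Measure Plane :=
  (countingMeasure X ω).restrict (Metric.closedBall 0 Rc)ᶜ

/-! ### Channel model -/

/-- Path loss at distance `r`. -/
def pathLoss (α d₀ r : ℝ) : ℝ := (1 + r / d₀) ^ (-α)

/-- The circularly symmetric complex Gaussian law `CN(0, 1)`: independent real and imaginary
parts, of variance `1/2` each. -/
def complexGaussian : Measure ℂ :=
  ((gaussianReal 0 (1 / 2)).prod (gaussianReal 0 (1 / 2))).map (fun p => (⟨p.1, p.2⟩ : ℂ))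

/-- The law `CN(0, I_M)` on `ℂ^M`. -/
def complexGaussianVec (M : ℕ) : Measure (AntennaVec M) :=
  (Measure.pi fun _ : Fin M => complexGaussian).map (WithLp.toLp 2)

/-! ### Zero-forcing beamforming -/

/-- The matrix with columns `g l`. -/
def columns {M : ℕ} {ι : Type*} (g : ι → AntennaVec M) : Matrix (Fin M) ι ℂ :=
  Matrix.of fun a l => g l a

/-- `I - G G†` with the left pseudo-inverse `G† = (Gᴴ G)⁻¹ Gᴴ`. -/
def nullProjector {M : ℕ} {ι : Type*} [Fintype ι] [DecidableEq ι] (G : Matrix (Fin M) ι ℂ) :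
    Matrix (Fin M) (Fin M) ℂ :=
  1 - G * ((G.conjTranspose * G)⁻¹ * G.conjTranspose)

/-- `v / ‖v‖`. -/
def normalized {M : ℕ} (v : AntennaVec M) : AntennaVec M := ((‖v‖ : ℂ)⁻¹) • v

/-- The normalized zero-forcing beam of user `i` at a BS with channels `g` (positive scalar factors
of the channels, such as the path loss, do not change it). -/
def zfBeam {M : ℕ} {ι : Type*} [Fintype ι] [DecidableEq ι] (g : ι → AntennaVec M) (i : ι) :
    AntennaVec M :=
  normalized (WithLp.toLp 2
    ((nullProjector (columns fun l : {l : ι // l ≠ i} => normalized (g l))).mulVec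
      (WithLp.ofLp (normalized (g i)))))

/-- The users handled by a BS: `K` scheduled users (`Sum.inl`) and `O` out-of-cell users at which
it nulls its interference (`Sum.inr`). -/
abbrev Users (K O : ℕ) : Type := Fin K ⊕ Fin O

/-- The scheduled users have orthogonal channels: all channels are linearly independent (so that
the zero-forcing beams exist), and the channels of any two scheduled users are orthogonal within
the subspace left after nulling the out-of-cell users. If `O = 0`, or if the scheduled channels are
orthogonal to the nulled ones, this is plain orthogonality of the scheduled channels. -/
def HasOrthogonalScheduledUsers {M K O : ℕ} (g : Users K O → AntennaVec M) : Prop :=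
  LinearIndependent ℂ g ∧
    Pairwise fun k l : Fin K =>
      inner ℂ (WithLp.toLp 2 ((nullProjector (columns fun o : Fin O => g (Sum.inr o))).mulVec
        (WithLp.ofLp (g (Sum.inl k))))) (g (Sum.inl l)) = 0

/-! ### Signal, interference, rate -/

/-- `ρ β(r) |hᴴ w|²`, for the user `i` served at distance `r`, with `w` the zero-forcing beam. -/
def signalPower {M K O : ℕ} (α d₀ ρ r : ℝ) (g : Users K O → AntennaVec M) (i : Fin K) : ℝ :=
  ρ * pathLoss α d₀ r * ‖inner ℂ (g (Sum.inl i)) (zfBeam g (Sum.inl i))‖ ^ 2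

open Classical in
/-- The interference `∑ₖ ρ β(‖x‖) |hᴴ wₖ|²` received at the origin from a BS at `x` that is outside
the cluster, and `0` for a BS in the cluster; `h` is the fading vector from this BS to the user, and
`wₖ` are the zero-forcing beams for the users with channels `c`. -/
def interferenceFrom {M K O : ℕ} (α d₀ ρ Rc : ℝ) (x : Plane) (h : AntennaVec M)
    (c : Users K O → AntennaVec M) : ℝ :=
  if Rc < ‖x‖ then
    ∑ k : Fin K, ρ * pathLoss α d₀ ‖x‖ * ‖inner ℂ h (zfBeam c (Sum.inl k))‖ ^ 2
  else 0

/-- Signal-to-interference-plus-noise ratio of user `i`. -/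
def sinr {M K O : ℕ} (α d₀ ρ Rc r : ℝ) (g : Users K O → AntennaVec M) (i : Fin K)
    (x : ℕ → Plane) (h : ℕ → AntennaVec M) (c : ℕ → Users K O → AntennaVec M) : ℝ :=
  signalPower α d₀ ρ r g i / ((∑' n, interferenceFrom α d₀ ρ Rc (x n) (h n) (c n)) + 1)

/-! ### The functions in the rate formula -/

open Classical in
/-- Gauss's hypergeometric function `₂F₁(a, b; c; x)` for real `x < 1`: the (unique) real-analytic
continuation to `(-∞, 1)` of the hypergeometric series. -/
def hyp2F1 (a b c x : ℝ) : ℝ :=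
  if h : ∃ f : ℝ → ℝ, AnalyticOnNhd ℝ f (Set.Iio 1) ∧
      ∀ y : ℝ, |y| < 1 → f y = ordinaryHypergeometric a b c y
  then h.choose x else 0

def PsiI (K : ℕ) (α d₀ ρ Rc s : ℝ) : ℝ :=
  d₀ ^ 2 / 2 * (1 + Rc / d₀) ^ 2 *
    (1 - hyp2F1 K (-(2 / α)) (1 - 2 / α) (-(s * ρ * (1 + Rc / d₀) ^ (-α))))

def PsiII (K : ℕ) (α d₀ ρ Rc s : ℝ) : ℝ :=
  d₀ ^ 2 * (1 + Rc / d₀) *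
    (1 - hyp2F1 K (-(1 / α)) (1 - 1 / α) (-(s * ρ * (1 + Rc / d₀) ^ (-α))))

/-- `F(r) = 1 - exp(-λ π r²)`, used for `r > 0`. -/
def Frmin (lam r : ℝ) : ℝ := 1 - Real.exp (-(lam * Real.pi * r ^ 2))

/-- The integrand, as a function of `z > 0`, of the rate formula. -/
def rateIntegrand (K ζ : ℕ) (lam α d₀ ρ τ Rc z : ℝ) : ℝ :=
  Real.exp (-(z * τ)) / z *
    Real.exp (2 * Real.pi * lam * (PsiI K α d₀ ρ Rc (z * τ) - PsiII K α d₀ ρ Rc (z * τ))) *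
    (1 - ∫ r in Set.Ioi (0 : ℝ),
      deriv (Frmin lam) r * (1 + z * ρ * (1 + r / d₀) ^ (-α)) ^ (-(ζ : ℤ)))

end

/-! ### Complex Gaussian vectors and their projections. -/

section ZeroForcing

open scoped ComplexConjugate

/-! Let S be the useful signal power and I the interference. For a > 0 and x ≥ 0, Frullani's
integral gives log(1 + x/a) = ∫ e^{-za} (1 - e^{-zx}) dz/z over (0, ∞) (`lintegral_frullani`). With
a = τ(1 + I) and x = S the rate becomes an integral of exponentials in I and S, and by Tonelli its
mean only needs the joint transform E[e^{-sI} e^{-zS}], at s = zτ. `ergodicRate_of_laplace` carries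
this out whenever the transform factors as A(s) q(z). There, A → 1 along some s → 0 forces I < ∞
almost surely, and 1 - q(z) ≤ κz offsets the factor 1/z, so that the integral converges.

The factorisation (`lintegral_expNeg_interference_mul_signal`) comes from averaging in the order
that the independence assumptions dictate. The fading of the interferers goes first, with all else
frozen: the K beams of an interferer are orthonormal (`orthonormal_zfBeam`), so the sum of the |hᴴ
wₖ|² is Gamma of shape K, and a BS at distance r > R_c contributes (1 + sρβ(r))^{-K}, whatever the
channels behind the beams. Next comes the fading of the serving BS: |h₀ᴴ w₀|² is the squared norm of
the projection of a Gaussian vector on the complement of the K + O - 1 other channels, almost surely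
of dimension ζ, which yields (1 + zρβ(r₀))^{-ζ}. What remains is a function of Φ_I times a function
of r₀, and these are independent.

The factor from Φ_I is given by the Laplace functional of a Poisson process
(`lintegral_expNeg_lintegral`). In polar coordinates, the substitution u = β(r)/β(R_c) splits the
exponent into two Euler type integrals with parameters δ = 2/α and δ = 1/α (`integral_cluster`), and
`hyp2F1_eq` identifies them with values of ₂F₁(K, -δ; 1 - δ; ·). The factor from r₀ is an average
against F', by the void probabilities of discs (`map_nearestDistance`). -/

instance : IsProbabilityMeasure complexGaussian := by
  unfold complexGaussian
  exact Measure.isProbabilityMeasure_map (by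
    have : Continuous fun p : ℝ × ℝ => (⟨p.1, p.2⟩ : ℂ) := by
      have : (fun p : ℝ × ℝ => (⟨p.1, p.2⟩ : ℂ)) = Complex.equivRealProdCLM.symm := rfl
      rw [this]; exact Complex.equivRealProdCLM.symm.continuous
    exact this.measurable.aemeasurable)

instance (M : ℕ) : IsProbabilityMeasure (complexGaussianVec M) := by
  unfold complexGaussianVec
  exact Measure.isProbabilityMeasure_map (by fun_prop)

theorem integral_complexGaussian {E : Type*} [NormedAddCommGroup E] [NormedSpace ℝ E]
    (f : ℂ → E) (hf : StronglyMeasurable f) :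
    ∫ z, f z ∂complexGaussian =
      ∫ p : ℝ × ℝ, f ⟨p.1, p.2⟩ ∂((gaussianReal 0 (1 / 2)).prod (gaussianReal 0 (1 / 2))) := by
  have : Continuous fun p : ℝ × ℝ => (⟨p.1, p.2⟩ : ℂ) := by
    have : (fun p : ℝ × ℝ => (⟨p.1, p.2⟩ : ℂ)) = Complex.equivRealProdCLM.symm := rfl
    rw [this]; exact Complex.equivRealProdCLM.symm.continuous
  unfold complexGaussian
  rw [integral_map this.measurable.aemeasurable hf.aestronglyMeasurable]

theorem integral_exp_mul_I_gaussianReal_half (t : ℝ) :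
    ∫ x, Complex.exp (2 * t * x * Complex.I) ∂(gaussianReal 0 (1 / 2)) =
      Complex.exp (-(t ^ 2 : ℝ)) := by
  have := charFun_gaussianReal (μ := 0) (v := 1 / 2) (2 * t)
  rw [charFun_apply_real] at this
  push_cast at this ⊢
  rw [this]
  congr 1
  ring

/-- The characteristic function of `CN(0, 1)`. -/
theorem integral_exp_re_mul_I_complexGaussian (v : ℂ) :
    ∫ z, Complex.exp ((2 * (conj v * z).re : ℝ) * Complex.I) ∂complexGaussian =
      Complex.exp (-(‖v‖ ^ 2 : ℝ)) := by
  rw [integral_complexGaussian _ (Continuous.stronglyMeasurable (by fun_prop))]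
  have h : ∀ p : ℝ × ℝ, Complex.exp ((2 * (conj v * (⟨p.1, p.2⟩ : ℂ)).re : ℝ) * Complex.I) =
      Complex.exp (2 * v.re * p.1 * Complex.I) * Complex.exp (2 * v.im * p.2 * Complex.I) := by
    intro p
    rw [← Complex.exp_add]
    congr 1
    simp only [Complex.mul_re, Complex.conj_re, Complex.conj_im]
    push_cast
    ring
  simp_rw [h]
  rw [integral_prod_mul (fun x : ℝ => Complex.exp (2 * v.re * x * Complex.I))
    (fun y : ℝ => Complex.exp (2 * v.im * y * Complex.I)),
    integral_exp_mul_I_gaussianReal_half, integral_exp_mul_I_gaussianReal_half,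
    ← Complex.exp_add]
  congr 1
  rw [Complex.sq_norm, Complex.normSq_apply]
  push_cast
  ring

theorem integral_exp_neg_mul_sq_gaussianReal_half {s : ℝ} (hs : 0 ≤ s) :
    ∫ x, Real.exp (-(s * x ^ 2)) ∂(gaussianReal 0 (1 / 2)) = √(1 / (1 + s)) := by
  rw [integral_gaussianReal_eq_integral_smul (by norm_num)]
  have h : ∀ x : ℝ, gaussianPDFReal 0 (1 / 2) x • Real.exp (-(s * x ^ 2)) =
      (√Real.pi)⁻¹ * Real.exp (-(1 + s) * x ^ 2) := by
    intro x
    rw [gaussianPDFReal, smul_eq_mul, mul_assoc, ← Real.exp_add]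
    have h1 : (2 * Real.pi * ((1 / 2 : NNReal) : ℝ)) = Real.pi := by push_cast; ring
    rw [h1]
    congr 2
    push_cast
    ring
  simp_rw [h]
  rw [integral_const_mul, integral_gaussian, ← Real.sqrt_inv, ← Real.sqrt_mul (by positivity)]
  congr 1
  have := Real.pi_pos
  field_simp

/-- The Laplace transform of `|z|²` for `z` of law `CN(0, 1)`. -/
theorem integral_exp_neg_mul_normSq_complexGaussian {s : ℝ} (hs : 0 ≤ s) :
    ∫ z, Real.exp (-(s * ‖z‖ ^ 2)) ∂complexGaussian = (1 + s)⁻¹ := by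
  rw [integral_complexGaussian _ (Continuous.stronglyMeasurable (by fun_prop))]
  have h : ∀ p : ℝ × ℝ, Real.exp (-(s * ‖(⟨p.1, p.2⟩ : ℂ)‖ ^ 2)) =
      Real.exp (-(s * p.1 ^ 2)) * Real.exp (-(s * p.2 ^ 2)) := by
    intro p
    rw [← Real.exp_add, Complex.sq_norm, Complex.normSq_apply]
    congr 1
    ring
  simp_rw [h]
  rw [integral_prod_mul (fun x : ℝ => Real.exp (-(s * x ^ 2)))
    (fun y : ℝ => Real.exp (-(s * y ^ 2))), integral_exp_neg_mul_sq_gaussianReal_half hs,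
    Real.mul_self_sqrt (by positivity), one_div]

theorem integral_exp_re_sum_mul_I_pi_complexGaussian {ι : Type*} [Fintype ι] (v : ι → ℂ) :
    ∫ z, Complex.exp ((2 * (∑ k, conj (v k) * z k).re : ℝ) * Complex.I)
      ∂(Measure.pi fun _ : ι => complexGaussian) = Complex.exp (-(∑ k, ‖v k‖ ^ 2 : ℝ)) := by
  have h : ∀ z : ι → ℂ, Complex.exp ((2 * (∑ k, conj (v k) * z k).re : ℝ) * Complex.I) =
      ∏ k, Complex.exp ((2 * (conj (v k) * z k).re : ℝ) * Complex.I) := by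
    intro z
    rw [← Complex.exp_sum, ← Finset.sum_mul]
    congr 2
    rw [Complex.re_sum, Finset.mul_sum]
    push_cast
    rfl
  simp_rw [h]
  rw [integral_fintype_prod_eq_prod
    (f := fun k z => Complex.exp ((2 * (conj (v k) * z).re : ℝ) * Complex.I))]
  simp_rw [integral_exp_re_mul_I_complexGaussian]
  rw [← Complex.exp_sum]
  congr 1
  push_cast
  simp

/-- The characteristic function of `CN(0, I)`. -/
theorem integral_exp_re_inner_mul_I_complexGaussianVec {M : ℕ} (v : AntennaVec M) :
    ∫ h, Complex.exp ((2 * (inner ℂ v h).re : ℝ) * Complex.I) ∂complexGaussianVec M =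
      Complex.exp (-(‖v‖ ^ 2 : ℝ)) := by
  unfold complexGaussianVec
  rw [integral_map (by fun_prop)
    (Continuous.stronglyMeasurable (by fun_prop)).aestronglyMeasurable]
  have := integral_exp_re_sum_mul_I_pi_complexGaussian (fun k => v k)
  rw [← EuclideanSpace.norm_sq_eq] at this
  rw [← this]
  congr 1
  ext z
  simp only [PiLp.inner_apply, RCLike.inner_apply]
  simp_rw [mul_comm]

/-- The squared norm of the projection of a `CN(0, I)` vector on a subspace of dimension `d` has
the Laplace transform of the Gamma law of shape `d`. -/
theorem integral_exp_neg_mul_sum_normSq_inner {M : ℕ} {ι : Type*} [Fintype ι]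
    {v : ι → AntennaVec M} (hv : Orthonormal ℂ v) {s : ℝ} (hs : 0 ≤ s) :
    ∫ h, Real.exp (-(s * ∑ k, ‖inner ℂ (v k) h‖ ^ 2)) ∂complexGaussianVec M =
      ((1 + s)⁻¹) ^ (Fintype.card ι) := by
  have hsq : (√s) ^ 2 = s := Real.sq_sqrt hs
  -- An auxiliary Gaussian vector z linearises the square: the exponent becomes linear in h, so
  -- after swapping the integrals the characteristic function of h applies.
  have e1 : ∀ h : AntennaVec M, (Real.exp (-(s * ∑ k, ‖inner ℂ (v k) h‖ ^ 2)) : ℂ) =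
      ∫ z, Complex.exp ((2 * (∑ k, conj ((√s : ℂ) * inner ℂ (v k) h) * z k).re : ℝ) * Complex.I)
        ∂(Measure.pi fun _ : ι => complexGaussian) := by
    intro h
    rw [integral_exp_re_sum_mul_I_pi_complexGaussian (fun k => (√s : ℂ) * inner ℂ (v k) h)]
    simp only [norm_mul, mul_pow, Complex.norm_real, Real.norm_eq_abs, sq_abs, hsq]
    rw [← Finset.mul_sum]
    push_cast
    rfl
  have e2 : ∀ (h : AntennaVec M) (z : ι → ℂ),
      (∑ k, conj ((√s : ℂ) * inner ℂ (v k) h) * z k).re =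
        (inner ℂ ((√s : ℂ) • ∑ k, z k • v k) h).re := by
    intro h z
    rw [← Complex.conj_re (inner ℂ _ h), inner_conj_symm, inner_smul_right, inner_sum,
      Finset.mul_sum]
    congr 2
    ext k
    rw [inner_smul_right, map_mul, Complex.conj_ofReal, inner_conj_symm]
    ring
  -- Orthonormality enters here: the transform in z then splits into independent coordinates.
  have e3 : ∀ z : ι → ℂ, ‖(√s : ℂ) • ∑ k, z k • v k‖ ^ 2 = ∑ k, s * ‖z k‖ ^ 2 := by
    intro z
    rw [norm_smul, mul_pow, Complex.norm_real, Real.norm_eq_abs, sq_abs, hsq, ← Finset.mul_sum]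
    congr 1
    have := hv.inner_sum z z Finset.univ
    rw [inner_self_eq_norm_sq_to_K] at this
    have h2 : ((‖∑ k, z k • v k‖ ^ 2 : ℝ) : ℂ) = ((∑ k, ‖z k‖ ^ 2 : ℝ) : ℂ) := by
      push_cast
      refine this.trans (Finset.sum_congr rfl fun k _ => ?_)
      rw [mul_comm, Complex.mul_conj, Complex.normSq_eq_norm_sq]
      push_cast
      rfl
    exact_mod_cast h2
  have hswap : ∫ h, (Real.exp (-(s * ∑ k, ‖inner ℂ (v k) h‖ ^ 2)) : ℂ) ∂complexGaussianVec M =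
      (((1 + s)⁻¹) ^ (Fintype.card ι) : ℝ) := by
    simp_rw [e1, e2]
    rw [integral_integral_swap]
    · simp_rw [integral_exp_re_inner_mul_I_complexGaussianVec, e3]
      have h3 : ∀ z : ι → ℂ, Complex.exp (-(∑ k, s * ‖z k‖ ^ 2 : ℝ)) =
          ((∏ k, Real.exp (-(s * ‖z k‖ ^ 2)) : ℝ) : ℂ) := by
        intro z
        rw [← Real.exp_sum, Finset.sum_neg_distrib]
        push_cast
        rfl
      simp_rw [h3]
      rw [integral_complex_ofReal, integral_fintype_prod_eq_prod
        (f := fun _ z => Real.exp (-(s * ‖z‖ ^ 2)))]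
      simp_rw [integral_exp_neg_mul_normSq_complexGaussian hs]
      simp
    · refine Integrable.of_bound (C := 1) ?_ (Filter.Eventually.of_forall fun p => ?_)
      · refine Continuous.aestronglyMeasurable ?_
        rw [Function.uncurry_def]
        fun_prop
      · rw [Function.uncurry_def, Complex.norm_exp_ofReal_mul_I]
  rw [integral_complex_ofReal] at hswap
  exact_mod_cast hswap

/-- For unit v the indicator of the hyperplane is at most exp(-s|⟨v, h⟩|²), whose mean (1 + s)⁻¹
tends to 0 as s → ∞. No density is needed. -/
theorem complexGaussianVec_inner_eq_zero {M : ℕ} {v : AntennaVec M} (hv : v ≠ 0) :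
    complexGaussianVec M {h | inner ℂ v h = 0} = 0 := by
  have hmeas : MeasurableSet {h : AntennaVec M | inner ℂ v h = 0} :=
    (isClosed_eq (by fun_prop) continuous_const).measurableSet
  wlog hn : ‖v‖ = 1 generalizing v
  · have h1 : ‖((‖v‖ : ℂ)⁻¹) • v‖ = 1 := by
      rw [norm_smul, norm_inv, Complex.norm_real, norm_norm, inv_mul_cancel₀ (norm_ne_zero_iff.2 hv)]
    have h2 : {h : AntennaVec M | inner ℂ v h = 0} =
        {h | inner ℂ (((‖v‖ : ℂ)⁻¹) • v) h = 0} := by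
      ext h
      simp [hv]
    rw [h2]
    refine this ?_ (h2 ▸ hmeas) h1
    intro h0
    rw [h0, norm_zero] at h1
    exact zero_ne_one h1
  have hv1 : Orthonormal ℂ fun _ : Unit => v := by
    refine ⟨fun _ => hn, fun i j hij => (hij (Subsingleton.elim i j)).elim⟩
  have hle : ∀ s : ℝ, 0 ≤ s →
      (complexGaussianVec M).real {h | inner ℂ v h = 0} ≤ (1 + s)⁻¹ := by
    intro s hs
    have h := integral_exp_neg_mul_sum_normSq_inner hv1 hs
    simp only [Finset.univ_unique, Finset.sum_const, Finset.card_singleton, one_smul,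
      Fintype.card_unit, pow_one] at h
    rw [← h, ← integral_indicator_one hmeas]
    refine integral_mono_of_nonneg (Filter.Eventually.of_forall fun h => ?_)
      (Integrable.of_bound (C := 1) (Continuous.aestronglyMeasurable (by fun_prop))
        (Filter.Eventually.of_forall fun h => ?_)) (Filter.Eventually.of_forall fun h => ?_)
    · exact Set.indicator_nonneg (fun _ _ => zero_le_one) h
    · rw [Real.norm_eq_abs, Real.abs_exp, Real.exp_le_one_iff, neg_nonpos]
      positivity
    · by_cases h0 : inner ℂ v h = 0
      · simp [h0]
      · simp only [Set.indicator, Set.mem_ofPred_eq, h0, if_false]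
        positivity
  have hlim : Filter.Tendsto (fun s : ℝ => (1 + s)⁻¹) Filter.atTop (nhds 0) :=
    tendsto_inv_atTop_zero.comp (Filter.tendsto_atTop_add_const_left _ _ Filter.tendsto_id)
  have h0 := ge_of_tendsto hlim ((Filter.eventually_ge_atTop 0).mono hle)
  rw [← measureReal_eq_zero_iff]
  exact le_antisymm h0 measureReal_nonneg

theorem complexGaussianVec_submodule_eq_zero {M : ℕ} {V : Submodule ℂ (AntennaVec M)}
    (hV : V ≠ ⊤) : complexGaussianVec M (V : Set (AntennaVec M)) = 0 := by
  have : Vᗮ ≠ ⊥ := fun h => hV ((Submodule.orthogonal_eq_bot_iff).1 h)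
  obtain ⟨v, hv, hv0⟩ := Submodule.exists_mem_ne_zero_of_ne_bot this
  refine measure_mono_null (fun h hh => ?_) (complexGaussianVec_inner_eq_zero hv0)
  exact (Submodule.mem_orthogonal' V v).1 hv h hh

/-- At most `M` independent `CN(0, I_M)` vectors are almost surely linearly independent. -/
theorem ae_linearIndependent_fin_complexGaussianVec {M : ℕ} :
    ∀ n ≤ M, ∀ᵐ g ∂(Measure.pi fun _ : Fin n => complexGaussianVec M), LinearIndependent ℂ g := by
  intro n
  induction n with
  | zero => exact fun _ => Filter.Eventually.of_forall fun g => linearIndependent_empty_type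
  | succ n ih =>
    intro hn
    have hmp := measurePreserving_piFinSuccAbove
      (fun _ : Fin (n + 1) => complexGaussianVec M) 0
    have hmeas : MeasurableSet {p : AntennaVec M × (Fin n → AntennaVec M) |
        LinearIndependent ℂ (Fin.cons p.1 p.2 : Fin (n + 1) → AntennaVec M)} := by
      have ho : IsOpen {g : Fin (n + 1) → AntennaVec M | LinearIndependent ℂ g} :=
        isOpen_setOfPred_linearIndependent
      refine (ho.preimage (f := fun p : AntennaVec M × (Fin n → AntennaVec M) =>
        (Fin.cons p.1 p.2 : Fin (n + 1) → AntennaVec M)) ?_).measurableSet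
      fun_prop
    have key : ∀ᵐ p ∂((complexGaussianVec M).prod
        (Measure.pi fun _ : Fin n => complexGaussianVec M)),
        LinearIndependent ℂ (Fin.cons p.1 p.2 : Fin (n + 1) → AntennaVec M) := by
      -- The n other vectors are fixed first: as n < M they span a proper subspace, which the new
      -- Gaussian vector almost surely avoids.
      rw [Measure.ae_prod_iff_ae_ae hmeas, Measure.ae_ae_comm hmeas]
      filter_upwards [ih (by omega)] with g hg
      have hV : Submodule.span ℂ (Set.range g) ≠ ⊤ := by
        intro htop
        have := finrank_range_le_card (R := ℂ) g
        rw [Set.finrank, htop, finrank_top, finrank_euclideanSpace, Fintype.card_fin,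
          Fintype.card_fin] at this
        omega
      have h0 := complexGaussianVec_submodule_eq_zero hV
      rw [measure_eq_zero_iff_ae_notMem] at h0
      filter_upwards [h0] with x hx
      rw [linearIndependent_finCons]
      exact ⟨hg, hx⟩
    have h2 := hmp.quasiMeasurePreserving.ae key
    filter_upwards [h2] with g hg
    have : (Fin.cons ((MeasurableEquiv.piFinSuccAbove (fun _ => AntennaVec M) 0) g).1
      ((MeasurableEquiv.piFinSuccAbove (fun _ => AntennaVec M) 0) g).2 :
        Fin (n + 1) → AntennaVec M) = g := by
      ext j
      refine Fin.cases ?_ (fun j => ?_) j <;> rfl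
    rwa [this] at hg

theorem ae_linearIndependent_complexGaussianVec {M : ℕ} {ι : Type*} [Fintype ι]
    (hι : Fintype.card ι ≤ M) :
    ∀ᵐ g ∂(Measure.pi fun _ : ι => complexGaussianVec M), LinearIndependent ℂ g := by
  have e := (Fintype.equivFin ι).symm
  have hmp := measurePreserving_piCongrLeft (fun _ : ι => complexGaussianVec M) e
  have h := hmp.symm.quasiMeasurePreserving.ae
    (ae_linearIndependent_fin_complexGaussianVec (M := M) _ hι)
  filter_upwards [h] with g hg
  exact (linearIndependent_equiv e).1 hg

/-! ### Zero-forcing beams as orthogonal projections. -/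

open scoped ComplexOrder

theorem toLp_columns_mulVec {M : ℕ} {ι : Type*} [Fintype ι] (g : ι → AntennaVec M) (c : ι → ℂ) :
    WithLp.toLp 2 ((columns g).mulVec c) = ∑ l, c l • g l := by
  ext a
  simp [columns, Matrix.mulVec, dotProduct, mul_comm]

theorem conjTranspose_columns_mulVec {M : ℕ} {ι : Type*} (g : ι → AntennaVec M)
    (x : AntennaVec M) (l : ι) :
    ((columns g).conjTranspose.mulVec (WithLp.ofLp x)) l = inner ℂ (g l) x := by
  simp [columns, Matrix.mulVec, dotProduct, PiLp.inner_apply, mul_comm]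

theorem isUnit_det_gram {M : ℕ} {ι : Type*} [Fintype ι] [DecidableEq ι] {g : ι → AntennaVec M}
    (hg : LinearIndependent ℂ g) : IsUnit ((columns g).conjTranspose * columns g).det := by
  rw [← Matrix.isUnit_iff_isUnit_det]
  refine Matrix.PosDef.isUnit (Matrix.PosDef.conjTranspose_mul_self _ fun c c' hc => ?_)
  have h := congrArg (WithLp.toLp 2) hc
  rw [toLp_columns_mulVec, toLp_columns_mulVec] at h
  rw [← sub_eq_zero, ← Finset.sum_sub_distrib] at h
  simp_rw [← sub_smul] at h
  exact funext fun l => sub_eq_zero.1 (Fintype.linearIndependent_iff.1 hg _ h l)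

/-- `I - G G†` is the orthogonal projection on the orthogonal complement of the columns of `G`. -/
theorem nullProjector_mulVec {M : ℕ} {ι : Type*} [Fintype ι] [DecidableEq ι]
    {g : ι → AntennaVec M} (hg : LinearIndependent ℂ g) (x : AntennaVec M) :
    WithLp.toLp 2 ((nullProjector (columns g)).mulVec (WithLp.ofLp x)) =
      (Submodule.span ℂ (Set.range g))ᗮ.starProjection x := by
  symm
  set y : AntennaVec M := WithLp.toLp 2 ((nullProjector (columns g)).mulVec (WithLp.ofLp x)) with hy
  -- The pseudo-inverse supplies the coefficients of x - y in the columns; it remains to see that y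
  -- is orthogonal to each column.
  have hsub : x - y = ∑ l, ((((columns g).conjTranspose * columns g)⁻¹ *
      (columns g).conjTranspose).mulVec (WithLp.ofLp x)) l • g l := by
    rw [← toLp_columns_mulVec, hy, nullProjector, Matrix.sub_mulVec, Matrix.one_mulVec,
      Matrix.mulVec_mulVec]
    ext a
    simp
  refine Submodule.eq_starProjection_of_mem_orthogonal ?_ ?_
  · rw [Submodule.mem_orthogonal]
    intro u hu
    have hle : Submodule.span ℂ (Set.range g) ≤ (Submodule.span ℂ {y})ᗮ := by
      rw [Submodule.span_le]
      rintro _ ⟨l, rfl⟩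
      rw [SetLike.mem_coe, Submodule.mem_orthogonal_singleton_iff_inner_left,
        ← conjTranspose_columns_mulVec, hy]
      simp only [Matrix.mulVec_mulVec]
      rw [nullProjector, Matrix.mul_sub, Matrix.mul_one, ← Matrix.mul_assoc, ← Matrix.mul_assoc,
        Matrix.mul_nonsing_inv _ (isUnit_det_gram hg), Matrix.one_mul, sub_self, Matrix.zero_mulVec]
      rfl
    exact (Submodule.mem_orthogonal_singleton_iff_inner_left).1 (hle hu)
  · rw [hsub]
    refine Submodule.le_orthogonal_orthogonal _ (Submodule.sum_mem _ fun l _ =>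
      Submodule.smul_mem _ _ (Submodule.subset_span ⟨l, rfl⟩))

theorem normalized_smul {M : ℕ} {c : ℝ} (hc : 0 < c) (v : AntennaVec M) :
    normalized ((c : ℂ) • v) = normalized v := by
  unfold normalized
  rw [norm_smul, Complex.norm_real, Real.norm_of_nonneg hc.le, smul_smul]
  push_cast
  rw [mul_inv_rev, mul_assoc, inv_mul_cancel₀ (by exact_mod_cast hc.ne'), mul_one]

theorem normalized_zero {M : ℕ} : normalized (0 : AntennaVec M) = 0 := by simp [normalized]

/-- The space that the beam of user `i` has to avoid. -/
abbrev otherSpan {M : ℕ} {ι : Type*} (g : ι → AntennaVec M) (i : ι) :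
    Submodule ℂ (AntennaVec M) :=
  Submodule.span ℂ (Set.range fun l : {l : ι // l ≠ i} => g l)

/-- Rescaling the channels changes neither their span nor the direction of a projection. Only the
channels to be avoided need be independent, which allows g i to be averaged with the others fixed.
-/
theorem zfBeam_eq {M : ℕ} {ι : Type*} [Fintype ι] [DecidableEq ι] {g : ι → AntennaVec M} {i : ι}
    (hg : LinearIndependent ℂ fun l : {l : ι // l ≠ i} => g l) :
    zfBeam g i = normalized ((otherSpan g i)ᗮ.starProjection (g i)) := by
  have hne : ∀ l : {l : ι // l ≠ i}, ((‖g l‖ : ℂ)⁻¹) ≠ 0 := fun l =>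
    inv_ne_zero (by exact_mod_cast norm_ne_zero_iff.2 (hg.ne_zero l))
  have hli : LinearIndependent ℂ fun l : {l : ι // l ≠ i} => normalized (g l) :=
    hg.units_smul fun l => Units.mk0 _ (hne l)
  have hspan : Submodule.span ℂ (Set.range fun l : {l : ι // l ≠ i} => normalized (g l)) =
      otherSpan g i := by
    refine le_antisymm (Submodule.span_le.2 ?_) (Submodule.span_le.2 ?_)
    · rintro _ ⟨l, rfl⟩
      exact Submodule.smul_mem _ _ (Submodule.subset_span ⟨l, rfl⟩)
    · rintro _ ⟨l, rfl⟩
      have : g l = (‖g l‖ : ℂ) • normalized (g l) := by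
        rw [normalized, smul_smul, mul_inv_cancel₀ (fun h0 => hne l (by rw [h0, inv_zero])), one_smul]
      change g l ∈ _
      rw [this]
      exact Submodule.smul_mem _ _ (Submodule.subset_span ⟨l, rfl⟩)
  rw [zfBeam, nullProjector_mulVec hli, hspan]
  by_cases h0 : g i = 0
  · simp [h0, normalized_zero]
  · have : normalized (g i) = ((‖g i‖⁻¹ : ℝ) : ℂ) • g i := by rw [normalized, Complex.ofReal_inv]
    rw [this, map_smul, normalized_smul (inv_pos.2 (norm_pos_iff.2 h0))]

/-- With p the projection of g i, the difference g i - p is orthogonal to p, so ⟨g i, p⟩ = ‖p‖². If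
p = 0, both sides vanish. -/
theorem norm_inner_zfBeam {M : ℕ} {ι : Type*} [Fintype ι] [DecidableEq ι] {g : ι → AntennaVec M}
    {i : ι} (hg : LinearIndependent ℂ fun l : {l : ι // l ≠ i} => g l) :
    ‖inner ℂ (g i) (zfBeam g i)‖ = ‖(otherSpan g i)ᗮ.starProjection (g i)‖ := by
  rw [zfBeam_eq hg, normalized, inner_smul_right]
  set p := (otherSpan g i)ᗮ.starProjection (g i) with hp
  have h1 : inner ℂ (g i) p = inner ℂ p p := by
    have h2 : g i - p ∈ (otherSpan g i)ᗮᗮ := Submodule.sub_starProjection_mem_orthogonal _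
    have h3 : inner ℂ (g i - p) p = 0 :=
      (Submodule.mem_orthogonal' _ _).1 h2 p (Submodule.starProjection_apply_mem _ _)
    rwa [inner_sub_left, sub_eq_zero] at h3
  rw [h1, inner_self_eq_norm_sq_to_K, norm_mul]
  by_cases h0 : ‖p‖ = 0
  · simp [h0]
  · simp
    field_simp

/-- With N the span of the nulled channels, the projection of a scheduled channel on Nᗮ is already
orthogonal to the other scheduled channels, so avoiding them as well changes nothing. The beams are
therefore normalised projections on Nᗮ, pairwise orthogonal by assumption. -/
theorem orthonormal_zfBeam {M K O : ℕ} {g : Users K O → AntennaVec M}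
    (h : HasOrthogonalScheduledUsers g) :
    Orthonormal ℂ fun k : Fin K => zfBeam g (Sum.inl k) := by
  obtain ⟨hg, ho⟩ := h
  set N := Submodule.span ℂ (Set.range fun o : Fin O => g (Sum.inr o)) with hN
  have hNli : LinearIndependent ℂ fun o : Fin O => g (Sum.inr o) :=
    hg.comp _ Sum.inr_injective
  have ho' : ∀ k l : Fin K, k ≠ l →
      inner ℂ (Nᗮ.starProjection (g (Sum.inl k))) (g (Sum.inl l)) = 0 := by
    intro k l hkl
    rw [← nullProjector_mulVec hNli]
    exact ho hkl
  have hproj : ∀ k : Fin K, (otherSpan g (Sum.inl k))ᗮ.starProjection (g (Sum.inl k)) =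
      Nᗮ.starProjection (g (Sum.inl k)) := by
    intro k
    have hle : N ≤ otherSpan g (Sum.inl k) := by
      rw [hN, Submodule.span_le]
      rintro _ ⟨o, rfl⟩
      exact Submodule.subset_span ⟨⟨Sum.inr o, by simp⟩, rfl⟩
    refine Submodule.eq_starProjection_of_mem_orthogonal ?_ ?_
    · rw [Submodule.mem_orthogonal]
      intro u hu
      have hle2 : otherSpan g (Sum.inl k) ≤
          (Submodule.span ℂ {Nᗮ.starProjection (g (Sum.inl k))})ᗮ := by
        rw [Submodule.span_le]
        rintro _ ⟨⟨l, hl⟩, rfl⟩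
        rw [SetLike.mem_coe, Submodule.mem_orthogonal_singleton_iff_inner_right]
        rcases l with l | o
        · exact ho' k l fun hkl => hl (by rw [hkl])
        · exact (Submodule.mem_orthogonal' _ _).1 (Submodule.starProjection_apply_mem _ _) _
            (Submodule.subset_span ⟨o, rfl⟩)
      exact (Submodule.mem_orthogonal_singleton_iff_inner_left).1 (hle2 hu)
    · refine Submodule.orthogonal_le (Submodule.orthogonal_le hle) ?_
      exact Submodule.sub_starProjection_mem_orthogonal _
  -- A zero projection would put a scheduled channel in the span of the nulled ones, against linear
  -- independence.
  have hne : ∀ k : Fin K, Nᗮ.starProjection (g (Sum.inl k)) ≠ 0 := by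
    intro k h0
    have hmem : g (Sum.inl k) ∈ Nᗮᗮ := by
      have := Submodule.sub_starProjection_mem_orthogonal (K := Nᗮ) (g (Sum.inl k))
      rwa [h0, sub_zero] at this
    rw [Submodule.orthogonal_orthogonal] at hmem
    refine hg.notMem_span_image (s := Set.range Sum.inr) (x := Sum.inl k) (by simp) ?_
    rwa [← Set.range_comp]
  have hbeam : ∀ k : Fin K,
      zfBeam g (Sum.inl k) = normalized (Nᗮ.starProjection (g (Sum.inl k))) := by
    intro k
    rw [zfBeam_eq (hg.comp _ Subtype.val_injective), hproj]
  refine ⟨fun k => ?_, fun k l hkl => ?_⟩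
  · beta_reduce
    rw [hbeam, normalized, norm_smul, norm_inv, Complex.norm_real, norm_norm,
      inv_mul_cancel₀ (norm_ne_zero_iff.2 (hne k))]
  · change inner ℂ (zfBeam g (Sum.inl k)) (zfBeam g (Sum.inl l)) = 0
    rw [hbeam, hbeam, normalized, normalized, inner_smul_left, inner_smul_right]
    have h3 : inner ℂ (Nᗮ.starProjection (g (Sum.inl k))) (Nᗮ.starProjection (g (Sum.inl l))) =
        (0 : ℂ) := by
      have h4 := (Submodule.mem_orthogonal _ _).1
        (Submodule.sub_starProjection_mem_orthogonal (K := Nᗮ) (g (Sum.inl l)))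
        (Nᗮ.starProjection (g (Sum.inl k))) (Submodule.starProjection_apply_mem _ _)
      rwa [inner_sub_right, ho' k l hkl, zero_sub, neg_eq_zero] at h4
    rw [h3, mul_zero, mul_zero]

/-! ### Measurability of the beams and law of the signal power. -/

theorem measurable_normalized {M : ℕ} : Measurable (normalized : AntennaVec M → AntennaVec M) := by
  unfold normalized
  fun_prop

/-- The inverse Gram matrix is the adjugate divided by the determinant, so everything is continuous
except one scalar inversion, which is still measurable. This covers dependent channels too. -/
theorem measurable_nullProjector_mulVec {M : ℕ} {ι : Type*} [Fintype ι] [DecidableEq ι] :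
    Measurable fun p : (ι → AntennaVec M) × AntennaVec M =>
      (WithLp.toLp 2 ((nullProjector (columns p.1)).mulVec (WithLp.ofLp p.2)) : AntennaVec M) := by
  have hcol : Continuous fun p : (ι → AntennaVec M) × AntennaVec M => columns p.1 := by
    unfold columns
    refine continuous_matrix fun a l => ?_
    simp only [Matrix.of_apply]
    fun_prop
  have hgram : Continuous fun p : (ι → AntennaVec M) × AntennaVec M =>
      (columns p.1).conjTranspose * columns p.1 :=
    (hcol.matrix_conjTranspose).matrix_mul hcol
  have hadj : Continuous fun p : (ι → AntennaVec M) × AntennaVec M =>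
      (WithLp.toLp 2 ((columns p.1 * (((columns p.1).conjTranspose * columns p.1).adjugate *
        (columns p.1).conjTranspose)).mulVec (WithLp.ofLp p.2)) : AntennaVec M) :=
    (PiLp.continuous_toLp 2 _).comp ((hcol.matrix_mul
      ((hgram.matrix_adjugate).matrix_mul hcol.matrix_conjTranspose)).matrix_mulVec
      ((PiLp.continuous_ofLp 2 _).comp continuous_snd))
  have heq : (fun p : (ι → AntennaVec M) × AntennaVec M =>
      (WithLp.toLp 2 ((nullProjector (columns p.1)).mulVec (WithLp.ofLp p.2)) : AntennaVec M)) =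
      fun p => p.2 - (((columns p.1).conjTranspose * columns p.1).det)⁻¹ •
        (WithLp.toLp 2 ((columns p.1 * (((columns p.1).conjTranspose * columns p.1).adjugate *
        (columns p.1).conjTranspose)).mulVec (WithLp.ofLp p.2)) : AntennaVec M) := by
    ext p
    rw [nullProjector, Matrix.sub_mulVec, Matrix.one_mulVec, Matrix.inv_def, Ring.inverse_eq_inv',
      Matrix.smul_mul, Matrix.mul_smul, Matrix.smul_mulVec]
    rfl
  rw [heq]
  exact measurable_snd.sub ((hgram.matrix_det.measurable.inv).smul hadj.measurable)

theorem measurable_zfBeam {M : ℕ} {ι : Type*} [Fintype ι] [DecidableEq ι] (i : ι) :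
    Measurable fun g : ι → AntennaVec M => zfBeam g i := by
  unfold zfBeam
  refine measurable_normalized.comp (measurable_nullProjector_mulVec.comp
    (f := fun g : ι → AntennaVec M =>
      ((fun l : {l : ι // l ≠ i} => normalized (g l)), normalized (g i))) ?_)
  refine Measurable.prodMk (measurable_pi_lambda _ fun l => ?_) ?_
  · exact measurable_normalized.comp (measurable_pi_apply _)
  · exact measurable_normalized.comp (measurable_pi_apply _)

/-- Parseval in an orthonormal basis of V reduces this to finitely many inner products. -/
theorem integral_exp_neg_mul_normSq_starProjection {M : ℕ} (V : Submodule ℂ (AntennaVec M))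
    {s : ℝ} (hs : 0 ≤ s) :
    ∫ h, Real.exp (-(s * ‖V.starProjection h‖ ^ 2)) ∂complexGaussianVec M =
      ((1 + s)⁻¹) ^ Module.finrank ℂ V := by
  set b := stdOrthonormalBasis ℂ V with hb
  have hv : Orthonormal ℂ fun k => (b k : AntennaVec M) :=
    b.orthonormal.comp_linearIsometry V.subtypeₗᵢ
  have h := integral_exp_neg_mul_sum_normSq_inner hv hs
  rw [Fintype.card_fin] at h
  rw [← h]
  congr 1
  ext x
  have h2 : ‖V.starProjection x‖ ^ 2 = ∑ k, ‖inner ℂ (b k : AntennaVec M) x‖ ^ 2 := by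
    have h3 := b.sum_sq_norm_inner_right (V.orthogonalProjectionOnto x)
    rw [Submodule.starProjection_apply, ← Submodule.coe_norm, ← h3]
    refine Finset.sum_congr rfl fun k _ => ?_
    rw [Submodule.coe_inner, ← Submodule.starProjection_apply,
      ← Submodule.inner_starProjection_left_eq_right, Submodule.starProjection_eq_self_iff.2 (b k).2]
  rw [h2]

/-- The Laplace transform of the useful signal power `|h₀ᴴ w₀|²`. -/
theorem integral_exp_neg_mul_normSq_inner_zfBeam {M ζ : ℕ} {ι : Type*} [Fintype ι] [DecidableEq ι]
    (i : ι) (hM : M + 1 = Fintype.card ι + ζ) (hζ : 1 ≤ ζ) {s : ℝ} (hs : 0 ≤ s) :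
    ∫ g, Real.exp (-(s * ‖inner ℂ (g i) (zfBeam g i)‖ ^ 2))
      ∂(Measure.pi fun _ : ι => complexGaussianVec M) = ((1 + s)⁻¹) ^ ζ := by
  -- Splitting off channel i: the others determine the subspace to project on, and channel i stays
  -- Gaussian once they are fixed.
  have hmp := (measurePreserving_piEquivPiSubtypeProd (fun _ : ι => complexGaussianVec M)
    (fun l => l = i)).symm
  rw [← hmp.integral_comp' (g := fun g => Real.exp (-(s * ‖inner ℂ (g i) (zfBeam g i)‖ ^ 2)))]
  have hmeas : Measurable fun g : ι → AntennaVec M =>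
      Real.exp (-(s * ‖inner ℂ (g i) (zfBeam g i)‖ ^ 2)) := by
    have := measurable_zfBeam (M := M) i
    fun_prop
  rw [integral_prod_symm]
  · have hcard : Fintype.card {l : ι // l ≠ i} = Fintype.card ι - 1 := by
      simp [Fintype.card_subtype_compl]
    have hpos : 0 < Fintype.card ι := Fintype.card_pos_iff.2 ⟨i⟩
    have hae := ae_linearIndependent_complexGaussianVec (M := M) (ι := {l : ι // ¬ l = i})
      (by rw [hcard]; omega)
    rw [integral_congr_ae (g := fun _ => ((1 + s)⁻¹) ^ ζ)]
    · simp
    · filter_upwards [hae] with b hb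
      set V := Submodule.span ℂ (Set.range b) with hV
      -- The other channels almost surely span dimension `card ι - 1`, leaving M + 1 - `card ι` = ζ.
      have hfin : Module.finrank ℂ Vᗮ = ζ := by
        have h1 := finrank_span_eq_card hb
        have h2 := Submodule.finrank_add_finrank_orthogonal V
        rw [finrank_euclideanSpace, Fintype.card_fin] at h2
        rw [← hV, hcard] at h1
        omega
      have hev := measurePreserving_eval
        (fun _ : {l : ι // l = i} => complexGaussianVec M) ⟨i, rfl⟩
      have hint := integral_map (μ := Measure.pi fun _ : {l : ι // l = i} => complexGaussianVec M)
        hev.measurable.aemeasurable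
        (f := fun h : AntennaVec M => Real.exp (-(s * ‖Vᗮ.starProjection h‖ ^ 2)))
        (Continuous.aestronglyMeasurable (by fun_prop))
      rw [hev.map_eq, integral_exp_neg_mul_normSq_starProjection Vᗮ hs, hfin] at hint
      beta_reduce
      rw [hint]
      congr 1
      · congr!
      funext a
      set g := (MeasurableEquiv.piEquivPiSubtypeProd (fun _ : ι => AntennaVec M)
        (fun l => l = i)).symm (a, b) with hgdef
      have hgi : g i = a ⟨i, rfl⟩ := by
        simp [hgdef, MeasurableEquiv.piEquivPiSubtypeProd, Equiv.piEquivPiSubtypeProd]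
      have hgl : (fun l : {l : ι // l ≠ i} => g l) = b := by
        funext l
        simp [hgdef, MeasurableEquiv.piEquivPiSubtypeProd, Equiv.piEquivPiSubtypeProd, l.2]
      rw [norm_inner_zfBeam (by rw [hgl]; exact hb), otherSpan, hgl, hgi]
  · refine Integrable.of_bound (C := 1)
      (hmeas.comp (MeasurableEquiv.measurable _)).aestronglyMeasurable
      (Filter.Eventually.of_forall fun g => ?_)
    rw [Real.norm_eq_abs, Real.abs_exp, Real.exp_le_one_iff, neg_nonpos]
    positivity

end ZeroForcing

/-! ### Exponentials of extended nonnegative numbers. -/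

/-- `exp (-x)` for an extended nonnegative number `x`. -/
noncomputable def expNeg (x : ENNReal) : ENNReal := EReal.exp (-(x : EReal))

theorem expNeg_zero : expNeg 0 = 1 := by simp [expNeg]

theorem expNeg_top : expNeg ⊤ = 0 := by simp [expNeg]

theorem expNeg_ofReal {x : ℝ} (hx : 0 ≤ x) :
    expNeg (ENNReal.ofReal x) = ENNReal.ofReal (Real.exp (-x)) := by
  rw [expNeg, EReal.coe_ennreal_ofReal, max_eq_left hx, ← EReal.coe_neg, EReal.exp_coe]

theorem continuous_expNeg : Continuous expNeg :=
  ENNReal.continuous_exp.comp (continuous_neg.comp continuous_coe_ennreal_ereal)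

theorem measurable_expNeg : Measurable expNeg := continuous_expNeg.measurable

theorem antitone_expNeg : Antitone expNeg := fun _ _ h =>
  EReal.exp_monotone (EReal.neg_le_neg_iff.2 (EReal.coe_ennreal_le_coe_ennreal_iff.2 h))

theorem expNeg_le_one (x : ENNReal) : expNeg x ≤ 1 := by
  rw [← expNeg_zero]; exact antitone_expNeg zero_le

theorem expNeg_add (x y : ENNReal) : expNeg (x + y) = expNeg x * expNeg y := by
  rw [expNeg, expNeg, expNeg, ← EReal.exp_add, EReal.coe_ennreal_add,
    EReal.neg_add (Or.inl (EReal.coe_ennreal_ne_bot _)) (Or.inr (EReal.coe_ennreal_ne_bot _)),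
    sub_eq_add_neg]

theorem expNeg_sum {ι : Type*} (s : Finset ι) (f : ι → ENNReal) :
    expNeg (∑ k ∈ s, f k) = ∏ k ∈ s, expNeg (f k) := by
  classical
  induction s using Finset.induction_on with
  | empty => simp [expNeg_zero]
  | insert a s ha ih => rw [Finset.sum_insert ha, Finset.prod_insert ha, expNeg_add, ih]

theorem expNeg_mul_natCast (a : ENNReal) (k : ℕ) : expNeg (a * k) = expNeg a ^ k := by
  have := expNeg_sum (Finset.range k) fun _ => a
  simpa [mul_comm] using this

theorem tendsto_prod_expNeg (f : ℕ → ENNReal) :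
    Filter.Tendsto (fun N => ∏ n ∈ Finset.range N, expNeg (f n)) Filter.atTop
      (nhds (expNeg (∑' n, f n))) := by
  simp_rw [← expNeg_sum]
  exact (continuous_expNeg.tendsto _).comp (ENNReal.tendsto_nat_tsum f)

/-- The generating function of a Poisson variable, summed by the exponential series at q = e^{-a}.
The case a = ∞ is q = 0. -/
theorem lintegral_expNeg_mul_poissonMeasure (m : NNReal) (a : ENNReal) :
    ∫⁻ k : ℕ, expNeg (a * k) ∂(poissonMeasure m) = expNeg (m * (1 - expNeg a)) := by
  have hfin : expNeg a ≠ ⊤ := ne_top_of_le_ne_top ENNReal.one_ne_top (expNeg_le_one a)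
  obtain ⟨q, hq⟩ : ∃ q : NNReal, (q : ENNReal) = expNeg a := ⟨_, ENNReal.coe_toNNReal hfin⟩
  have hq1 : (q : ℝ) ≤ 1 := by
    have := expNeg_le_one a
    rw [← hq] at this
    exact_mod_cast this
  have h1 : ENNReal.ofReal (Real.exp (-(m * (1 - q)))) = expNeg (m * (1 - expNeg a)) := by
    rw [← hq, ← expNeg_ofReal (mul_nonneg m.coe_nonneg (sub_nonneg.2 hq1)),
      ENNReal.ofReal_mul m.coe_nonneg,
      ENNReal.ofReal_sub _ q.coe_nonneg]
    simp
  have h2 : ∀ k : ℕ, expNeg (a * k) = ENNReal.ofReal ((q : ℝ) ^ k) := by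
    intro k
    rw [expNeg_mul_natCast, ← hq, ENNReal.ofReal_pow q.coe_nonneg, ENNReal.ofReal_coe_nnreal]
  have hsum : HasSum (fun k : ℕ => Real.exp (-m) * m ^ k / k.factorial * (q : ℝ) ^ k)
      (Real.exp (-(m * (1 - q)))) := by
    have h3 := (NormedSpace.expSeries_div_hasSum_exp ((m : ℝ) * q)).mul_left (Real.exp (-m))
    rw [← Real.exp_eq_exp_ℝ, ← Real.exp_add] at h3
    have h4 : -(m : ℝ) + m * q = -(m * (1 - q)) := by ring
    rw [h4] at h3
    exact h3.congr_fun fun k => by rw [mul_pow]; ring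
  rw [← h1, ← hsum.tsum_eq, ENNReal.ofReal_tsum_of_nonneg (fun k => by positivity) hsum.summable,
    poissonMeasure, lintegral_sum_measure]
  congr 1
  ext k
  rw [lintegral_smul_measure, lintegral_dirac, h2, ENNReal.ofReal_mul (by positivity), smul_eq_mul]

/-! ### The Laplace functional and the void probabilities of a Poisson process. -/

theorem lintegral_countingMeasure {Ω E : Type*} [MeasurableSpace E] (X : ℕ → Ω → E) (ω : Ω)
    {f : E → ENNReal} (hf : Measurable f) :
    ∫⁻ x, f x ∂countingMeasure X ω = ∑' n, f (X n ω) := by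
  rw [countingMeasure, lintegral_sum_measure]
  congr 1
  ext n
  rw [lintegral_dirac' _ hf]

theorem measurable_lintegral_countingMeasure {Ω E : Type*} [MeasurableSpace Ω] [MeasurableSpace E]
    {X : ℕ → Ω → E} (hX : ∀ n, Measurable (X n)) {f : E → ENNReal} (hf : Measurable f) :
    Measurable fun ω => ∫⁻ x, f x ∂countingMeasure X ω := by
  simp_rw [lintegral_countingMeasure X _ hf]
  exact Measurable.tsum fun n => hf.comp (hX n)

theorem measurable_countingMeasure_apply {Ω E : Type*} [MeasurableSpace Ω] [MeasurableSpace E]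
    {X : ℕ → Ω → E} (hX : ∀ n, Measurable (X n)) {A : Set E} (hA : MeasurableSet A) :
    Measurable fun ω => countingMeasure X ω A := by
  simp_rw [← lintegral_indicator_one hA]
  exact measurable_lintegral_countingMeasure hX (measurable_one.indicator hA)

namespace IsPoissonPointProcess

variable {Ω E : Type*} [MeasurableSpace Ω] [MeasurableSpace E] {P : Measure Ω}
  {X : ℕ → Ω → E} {ν : Measure E}

theorem lintegral_expNeg_mul_count (hX : IsPoissonPointProcess P X ν) {A : Set E}
    (hA : MeasurableSet A) (hfin : ν A < ⊤) (a : ENNReal) :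
    ∫⁻ ω, expNeg (a * countingMeasure X ω A) ∂P = expNeg ((1 - expNeg a) * ν A) := by
  have hm : Measurable fun x => expNeg (a * x) := measurable_expNeg.comp (by fun_prop)
  rw [← lintegral_map (f := fun x => expNeg (a * x)) hm
    (measurable_countingMeasure_apply hX.measurable hA), hX.poisson A hA hfin,
    lintegral_map hm .of_discrete, lintegral_expNeg_mul_poissonMeasure,
    ENNReal.coe_toNNReal hfin.ne, mul_comm]

/-- Counts in disjoint sets are independent, so the transform is a product of Poisson transforms. -/
theorem lintegral_expNeg_sum_count (hX : IsPoissonPointProcess P X ν) {ι : Type*} [Fintype ι]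
    {A : ι → Set E} (hA : ∀ i, MeasurableSet (A i))
    (hdisj : Pairwise fun i j => Disjoint (A i) (A j)) (hfin : ∀ i, ν (A i) < ⊤)
    (a : ι → ENNReal) :
    ∫⁻ ω, expNeg (∑ i, a i * countingMeasure X ω (A i)) ∂P =
      expNeg (∑ i, (1 - expNeg (a i)) * ν (A i)) := by
  set e := (Fintype.equivFin ι).symm
  have hind := hX.indep _ (fun j => A (e j)) (fun j => hA _) fun i j hij =>
    hdisj (e.injective.ne hij)
  have hm : ∀ j, Measurable fun x => expNeg (a (e j) * x) := fun j =>
    measurable_expNeg.comp (by fun_prop)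
  have hcomp := hind.comp (fun j x => expNeg (a (e j) * x)) hm
  simp_rw [expNeg_sum, ← hX.lintegral_expNeg_mul_count (hA _) (hfin _), ← e.prod_comp]
  exact lintegral_prod_eq_prod_lintegral_of_indepFun Finset.univ _ hcomp fun j =>
    (hm j).comp (measurable_countingMeasure_apply hX.measurable (hA _))

/-- The Laplace functional of a Poisson point process. -/
theorem lintegral_expNeg_lintegral [IsProbabilityMeasure P] [SigmaFinite ν]
    (hX : IsPoissonPointProcess P X ν) {f : E → ENNReal} (hf : Measurable f) :
    ∫⁻ ω, expNeg (∫⁻ x, f x ∂countingMeasure X ω) ∂P =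
      expNeg (∫⁻ x, (1 - expNeg (f x)) ∂ν) := by
  -- Only sets of finite intensity have Poisson counts, so f is approximated by simple functions cut
  -- off to an exhaustion by such sets. Their level sets are disjoint, and both sides pass to the
  -- limit.
  set S := spanningSets ν with hS
  set u := SimpleFunc.eapprox f with hu
  have hSm : ∀ n, MeasurableSet (S n) := measurableSet_spanningSets ν
  have happrox : ∀ n, ∫⁻ ω, expNeg (∫⁻ x, (S n).indicator (u n) x ∂countingMeasure X ω) ∂P =
      expNeg (∫⁻ x, (1 - expNeg ((S n).indicator (u n) x)) ∂ν) := by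
    intro n
    have h1 : ∀ ω, ∫⁻ x, (S n).indicator (u n) x ∂countingMeasure X ω =
        ∑ y : (u n).range, (y : ENNReal) * countingMeasure X ω (u n ⁻¹' {y.1} ∩ S n) := by
      intro ω
      rw [lintegral_indicator (hSm n), SimpleFunc.lintegral_eq_lintegral,
        SimpleFunc.lintegral_restrict, ← Finset.sum_coe_sort]
    have h2 : ∫⁻ x, (1 - expNeg ((S n).indicator (u n) x)) ∂ν =
        ∑ y : (u n).range, (1 - expNeg y) * ν (u n ⁻¹' {y.1} ∩ S n) := by
      have h3 : ∀ x, 1 - expNeg ((S n).indicator (u n) x) =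
          (S n).indicator (((u n).map fun y => 1 - expNeg y : SimpleFunc E ENNReal)) x := by
        intro x
        by_cases hx : x ∈ S n <;> simp [hx, expNeg_zero]
      simp_rw [h3]
      rw [lintegral_indicator (hSm n), SimpleFunc.lintegral_eq_lintegral,
        SimpleFunc.map_lintegral, ← Finset.sum_coe_sort]
      simp_rw [Measure.restrict_apply ((u n).measurableSet_preimage _)]
    simp_rw [h1, h2]
    refine hX.lintegral_expNeg_sum_count
      (fun y => ((u n).measurableSet_preimage _).inter (hSm n)) (fun y z hyz => ?_)
      (fun y => (measure_mono Set.inter_subset_right).trans_lt (measure_spanningSets_lt_top ν n)) _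
    refine Disjoint.mono Set.inter_subset_left Set.inter_subset_left ?_
    exact Disjoint.preimage _ (Set.disjoint_singleton.2 fun h => hyz (Subtype.ext h))
  have hmeas : ∀ n, Measurable ((S n).indicator (u n)) := fun n =>
    (u n).measurable.indicator (hSm n)
  have hmono : ∀ x, Monotone fun n => (S n).indicator (u n) x := by
    intro x m n hmn
    beta_reduce
    by_cases hx : x ∈ S m
    · rw [Set.indicator_of_mem hx, Set.indicator_of_mem (monotone_spanningSets ν hmn hx)]
      exact SimpleFunc.monotone_eapprox f hmn x
    · rw [Set.indicator_of_notMem hx]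
      exact zero_le
  have hlim : ∀ x, Filter.Tendsto (fun n => (S n).indicator (u n) x) Filter.atTop
      (nhds (f x)) := by
    intro x
    refine (SimpleFunc.tendsto_eapprox hf x).congr' ?_
    filter_upwards [Filter.eventually_ge_atTop (spanningSetsIndex ν x)] with n hn
    rw [Set.indicator_of_mem (mem_spanningSets_of_index_le ν x hn)]
  have hL : Filter.Tendsto
      (fun n => ∫⁻ ω, expNeg (∫⁻ x, (S n).indicator (u n) x ∂countingMeasure X ω) ∂P)
      Filter.atTop (nhds (∫⁻ ω, expNeg (∫⁻ x, f x ∂countingMeasure X ω) ∂P)) := by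
    refine tendsto_lintegral_of_dominated_convergence (fun _ => 1)
      (fun n => measurable_expNeg.comp
        (measurable_lintegral_countingMeasure hX.measurable (hmeas n)))
      (fun n => Filter.Eventually.of_forall fun ω => expNeg_le_one _) (by simp)
      (Filter.Eventually.of_forall fun ω => ?_)
    exact (continuous_expNeg.tendsto _).comp (lintegral_tendsto_of_tendsto_of_monotone
      (fun n => (hmeas n).aemeasurable) (Filter.Eventually.of_forall hmono)
      (Filter.Eventually.of_forall hlim))
  have hR : Filter.Tendsto (fun n => expNeg (∫⁻ x, (1 - expNeg ((S n).indicator (u n) x)) ∂ν))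
      Filter.atTop (nhds (expNeg (∫⁻ x, (1 - expNeg (f x)) ∂ν))) := by
    refine (continuous_expNeg.tendsto _).comp (lintegral_tendsto_of_tendsto_of_monotone
      (fun n => (measurable_const.sub (measurable_expNeg.comp (hmeas n))).aemeasurable)
      (Filter.Eventually.of_forall fun x m n hmn =>
        tsub_le_tsub_left (antitone_expNeg (hmono x hmn)) _)
      (Filter.Eventually.of_forall fun x => ?_))
    exact ENNReal.Tendsto.sub tendsto_const_nhds ((continuous_expNeg.tendsto _).comp (hlim x))
      (Or.inl ENNReal.one_ne_top)
  simp_rw [happrox] at hL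
  exact tendsto_nhds_unique hL hR

theorem measure_count_eq_zero (hX : IsPoissonPointProcess P X ν) {A : Set E}
    (hA : MeasurableSet A) (hfin : ν A < ⊤) :
    P {ω | countingMeasure X ω A = 0} = expNeg (ν A) := by
  have h1 : P {ω | countingMeasure X ω A = 0} = P.map (fun ω => countingMeasure X ω A) {0} := by
    rw [Measure.map_apply (measurable_countingMeasure_apply hX.measurable hA)
      (measurableSet_singleton _)]
    rfl
  have h2 : ((fun k : ℕ => (k : ENNReal)) ⁻¹' {0}) = {0} := by
    ext k
    simp
  rw [h1, hX.poisson A hA hfin, Measure.map_apply .of_discrete (measurableSet_singleton _), h2,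
    poissonMeasure_singleton]
  simp only [pow_zero, mul_one, Nat.factorial_zero, Nat.cast_one, div_one]
  rw [← expNeg_ofReal (NNReal.coe_nonneg _), ENNReal.ofReal_coe_nnreal,
    ENNReal.coe_toNNReal hfin.ne]

end IsPoissonPointProcess

/-! ### The law of the distance to the nearest BS. -/

theorem hasDerivAt_Frmin (lam t : ℝ) :
    HasDerivAt (Frmin lam) (2 * lam * Real.pi * t * Real.exp (-(lam * Real.pi * t ^ 2))) t := by
  have h1 : HasDerivAt (fun t : ℝ => -(lam * Real.pi * t ^ 2)) (-(lam * Real.pi * (2 * t))) t := by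
    simpa using (((hasDerivAt_id' t).fun_pow 2).const_mul (lam * Real.pi)).fun_neg
  exact ((h1.exp).const_sub 1).congr_deriv (by ring)

theorem deriv_Frmin (lam t : ℝ) :
    deriv (Frmin lam) t = 2 * lam * Real.pi * t * Real.exp (-(lam * Real.pi * t ^ 2)) :=
  (hasDerivAt_Frmin lam t).deriv

/-- The law with density `F'` on `(0, ∞)`. -/
noncomputable def nearestLaw (lam : ℝ) : Measure ℝ :=
  (volume.restrict (Set.Ioi 0)).withDensity fun t => ENNReal.ofReal (deriv (Frmin lam) t)

theorem nearestLaw_Ici {lam : ℝ} (hlam : 0 < lam) (t : ℝ) :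
    nearestLaw lam (Set.Ici t) =
      ENNReal.ofReal (Real.exp (-(lam * Real.pi * (max t 0) ^ 2))) := by
  have hpi := Real.pi_pos
  have hset : (Set.Ici t ∩ Set.Ioi 0 : Set ℝ) =ᵐ[volume] Set.Ioi (max t 0) := by
    have : Set.Ioi (max t 0) = (Set.Ioi t ∩ Set.Ioi 0 : Set ℝ) := Set.Ioi_inter_Ioi.symm
    rw [this]
    exact (Ioi_ae_eq_Ici (a := t)).symm.inter (ae_eq_refl _)
  have hlim : Filter.Tendsto (Frmin lam) Filter.atTop (nhds 1) := by
    unfold Frmin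
    have h1 : Filter.Tendsto (fun r : ℝ => lam * Real.pi * r ^ 2) Filter.atTop Filter.atTop :=
      (Filter.tendsto_pow_atTop two_ne_zero).const_mul_atTop (by positivity)
    simpa using (Real.tendsto_exp_neg_atTop_nhds_zero.comp h1).const_sub 1
  have hderiv : ∀ x ∈ Set.Ioi (max t 0), HasDerivAt (Frmin lam) (deriv (Frmin lam) x) x :=
    fun x _ => (hasDerivAt_Frmin lam x).differentiableAt.hasDerivAt
  have hnn : ∀ x ∈ Set.Ioi (max t 0), 0 ≤ deriv (Frmin lam) x := by
    intro x hx
    have : 0 < x := (le_max_right t 0).trans_lt hx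
    rw [deriv_Frmin]
    positivity
  have hcont : ContinuousWithinAt (Frmin lam) (Set.Ici (max t 0)) (max t 0) :=
    (hasDerivAt_Frmin lam _).continuousAt.continuousWithinAt
  rw [nearestLaw, withDensity_apply _ measurableSet_Ici, Measure.restrict_restrict measurableSet_Ici,
    Measure.restrict_congr_set hset, ← ofReal_integral_eq_lintegral_ofReal
      (integrableOn_Ioi_deriv_of_nonneg hcont hderiv hnn hlim)
      ((ae_restrict_iff' measurableSet_Ioi).2 (Filter.Eventually.of_forall hnn)),
    integral_Ioi_of_hasDerivAt_of_nonneg hcont hderiv hnn hlim, Frmin]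
  congr 1
  ring

/-- The nearest distance is at least t exactly when the open disc of radius t is empty, and
half-lines [t, ∞) determine a probability measure on ℝ. -/
theorem map_nearestDistance {Ω : Type*} [MeasurableSpace Ω] {P : Measure Ω}
    [IsProbabilityMeasure P] {X : ℕ → Ω → Plane} {lam : ℝ} (hlam : 0 < lam)
    (hX : IsHomogeneousPPP P X lam) : P.map (nearestDistance X) = nearestLaw lam := by
  have hmeas : Measurable (nearestDistance X) := by
    unfold nearestDistance
    exact Measurable.iInf fun n => (hX.measurable n).norm
  have := Measure.isProbabilityMeasure_map (μ := P) hmeas.aemeasurable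
  refine Measure.ext_of_Ici _ _ fun t => ?_
  rw [Measure.map_apply hmeas measurableSet_Ici, nearestLaw_Ici hlam]
  -- For t ≤ 0 the ball is empty, hence the maximum with 0.
  have hball : (ENNReal.ofReal lam • (volume : Measure Plane)) (Metric.ball 0 t) =
      ENNReal.ofReal (lam * Real.pi * (max t 0) ^ 2) := by
    rw [Measure.smul_apply, EuclideanSpace.volume_ball_fin_two, smul_eq_mul, mul_assoc,
      ENNReal.ofReal_mul hlam.le, mul_comm Real.pi, ENNReal.ofReal_mul (by positivity),
      ENNReal.ofReal_pow (le_max_right _ _), ENNReal.ofReal_max]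
    simp [← NNReal.coe_real_pi, ENNReal.ofReal_coe_nnreal]
  have hset : nearestDistance X ⁻¹' Set.Ici t =
      {ω | countingMeasure X ω (Metric.ball 0 t) = 0} := by
    ext ω
    rw [Set.mem_preimage, Set.mem_Ici, nearestDistance, le_ciInf_iff ⟨0, by
      rintro _ ⟨n, rfl⟩; exact norm_nonneg _⟩]
    simp [countingMeasure, Measure.sum_apply _ Metric.isOpen_ball.measurableSet,
      Measure.dirac_apply' _ Metric.isOpen_ball.measurableSet]
  rw [hset, hX.measure_count_eq_zero Metric.isOpen_ball.measurableSet, hball, expNeg_ofReal]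
  · have := Real.pi_pos
    positivity
  · rw [hball]
    exact ENNReal.ofReal_lt_top

/-! ### The hypergeometric function as an Euler type integral. -/

theorem ascPochhammer_eval_neg_mul (δ : ℝ) (n : ℕ) :
    (ascPochhammer ℝ n).eval (-δ) * (n - δ) = -δ * (ascPochhammer ℝ n).eval (1 - δ) := by
  induction n with
  | zero => simp
  | succ n ih =>
    rw [ascPochhammer_succ_eval, ascPochhammer_succ_eval]
    push_cast
    linear_combination (n + 1 - δ) * ih

/-- The quotient (-δ)ₙ/(1 - δ)ₙ telescopes to -δ/(n - δ), and (k + 1)ₙ/n! is a binomial coefficient;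
here k + 1 plays the role of K. -/
theorem hypergeometric_coeff {δ : ℝ} (hδ0 : 0 < δ) (hδ1 : δ < 1) (k n : ℕ) :
    (n.factorial : ℝ)⁻¹ * (ascPochhammer ℝ n).eval ((k + 1 : ℕ) : ℝ) *
      (ascPochhammer ℝ n).eval (-δ) * ((ascPochhammer ℝ n).eval (1 - δ))⁻¹ =
      (n + k).choose k * (-δ / (n - δ)) := by
  have h1 : (ascPochhammer ℝ n).eval ((k + 1 : ℕ) : ℝ) = n.factorial * (n + k).choose k := by
    rw [← ascPochhammer_eval_cast, ascPochhammer_nat_eq_ascFactorial,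
      Nat.ascFactorial_eq_factorial_mul_choose, Nat.add_comm n k, Nat.choose_symm_add]
    push_cast
    rfl
  have h2 : (ascPochhammer ℝ n).eval (1 - δ) ≠ 0 := (ascPochhammer_pos n _ (by linarith)).ne'
  have h3 : (n : ℝ) - δ ≠ 0 := by
    rcases Nat.eq_zero_or_pos n with h | h
    · subst h
      simpa using hδ0.ne'
    · have : (1 : ℝ) ≤ n := by exact_mod_cast h
      linarith
  have h4 := ascPochhammer_eval_neg_mul δ n
  have h5 : (n.factorial : ℝ) ≠ 0 := by positivity
  rw [h1]
  field_simp
  linear_combination ((n + k).choose k : ℝ) * h4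

theorem integrableOn_rpow_Ioc {e : ℝ} (he : -1 < e) :
    IntegrableOn (fun u : ℝ => u ^ e) (Set.Ioc 0 1) :=
  (intervalIntegrable_iff_integrableOn_Ioc_of_le zero_le_one).1
    (intervalIntegral.intervalIntegrable_rpow' he)

theorem integral_rpow_Ioc {e : ℝ} (he : -1 < e) :
    ∫ u in Set.Ioc (0 : ℝ) 1, u ^ e = (e + 1)⁻¹ := by
  rw [← intervalIntegral.integral_of_le zero_le_one, integral_rpow (Or.inl he), Real.one_rpow,
    Real.zero_rpow (by linarith), sub_zero, one_div]

theorem one_sub_mul_pos {y u : ℝ} (hy : y < 1) (hu : u ∈ Set.Ioc (0 : ℝ) 1) : 0 < 1 - y * u := by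
  nlinarith [hu.1, hu.2]

/-- The finite geometric sum extracts a factor u from 1 - (1 - yu)^{-K}, turning the non-integrable
weight u^{-δ-1} into the integrable u^{-δ}. -/
theorem rpow_mul_one_sub_pow_eq {δ y u : ℝ} (K : ℕ) (hy : y < 1) (hu : u ∈ Set.Ioc (0 : ℝ) 1) :
    u ^ (-δ - 1) * (1 - ((1 - y * u)⁻¹) ^ K) =
      -y * ∑ j ∈ Finset.range K, u ^ (-δ) * ((1 - y * u)⁻¹) ^ (j + 1) := by
  have h1 := (one_sub_mul_pos hy hu).ne'
  have h2 := mul_neg_geom_sum ((1 - y * u)⁻¹) K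
  have h3 : 1 - (1 - y * u)⁻¹ = -(y * u) * (1 - y * u)⁻¹ := by
    field_simp
    ring
  rw [← h2, h3, Real.rpow_sub_one hu.1.ne', ← Finset.mul_sum]
  simp_rw [pow_succ]
  rw [← Finset.sum_mul]
  have := hu.1.ne'
  field_simp

theorem norm_one_sub_mul_ge {ε : ℝ} {w : ℂ} {u : ℝ} (hε : ε ≤ 1) (hw : w.re ≤ 1 - ε)
    (hu : u ∈ Set.Ioc (0 : ℝ) 1) : ε ≤ ‖1 - w * u‖ := by
  refine le_trans ?_ (Complex.re_le_norm _)
  rw [Complex.sub_re, Complex.one_re, Complex.re_mul_ofReal]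
  nlinarith [hu.1, hu.2]

/-- Holomorphy on the half-plane Re w < 1 gives real analyticity on all of (-∞, 1), beyond the disc
of convergence of the series. It follows by differentiating under the integral. -/
theorem differentiableOn_integral_rpow_mul_inv_pow {δ : ℝ} (hδ1 : δ < 1) (j : ℕ) :
    DifferentiableOn ℂ (fun w : ℂ => ∫ u in Set.Ioc (0 : ℝ) 1,
      ((u ^ (-δ) : ℝ) : ℂ) * ((1 - w * u)⁻¹) ^ j) {w | w.re < 1} := by
  intro w₀ hw₀
  have hw₀' : w₀.re < 1 := hw₀
  -- For Re w < 1 - ε and u in (0, 1], |1 - wu| ≥ ε; the cap ε ≤ 1 handles negative Re w.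
  set ε := min 1 ((1 - w₀.re) / 2) with hε
  have hε0 : 0 < ε := lt_min one_pos (by linarith)
  have hε1 : ε ≤ 1 := min_le_left _ _
  have hw₀s : w₀.re < 1 - ε := by
    have : ε ≤ (1 - w₀.re) / 2 := min_le_right _ _
    linarith
  have hs : {w : ℂ | w.re < 1 - ε} ∈ nhds w₀ := by
    exact (isOpen_lt Complex.continuous_re continuous_const).mem_nhds hw₀s
  have hlow : ∀ w : ℂ, w.re < 1 - ε → ∀ u ∈ Set.Ioc (0 : ℝ) 1, ‖(1 - w * u)⁻¹‖ ≤ ε⁻¹ := by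
    intro w hw u hu
    rw [norm_inv]
    exact inv_anti₀ hε0 (norm_one_sub_mul_ge hε1 hw.le hu)
  have hint := integrableOn_rpow_Ioc (e := -δ) (by linarith)
  have hbd : Integrable (fun u : ℝ => u ^ (-δ) * (ε⁻¹) ^ j) (volume.restrict (Set.Ioc 0 1)) :=
    hint.mul_const _
  have key := hasDerivAt_integral_of_dominated_loc_of_deriv_le
    (μ := volume.restrict (Set.Ioc (0 : ℝ) 1)) (x₀ := w₀)
    (F := fun (w : ℂ) (u : ℝ) => ((u ^ (-δ) : ℝ) : ℂ) * ((1 - w * u)⁻¹) ^ j)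
    (F' := fun (w : ℂ) (u : ℝ) => ((u ^ (-δ) : ℝ) : ℂ) *
      (j * ((1 - w * u)⁻¹) ^ (j - 1) * (u * ((1 - w * u)⁻¹) ^ 2)))
    (bound := fun u : ℝ => u ^ (-δ) * (j * (ε⁻¹) ^ (j - 1) * (1 * (ε⁻¹) ^ 2))) hs ?_ ?_ ?_ ?_ ?_ ?_
  · exact key.2.differentiableAt.differentiableWithinAt
  · exact Filter.Eventually.of_forall fun w => by
      have : Measurable fun u : ℝ => ((u ^ (-δ) : ℝ) : ℂ) * ((1 - w * u)⁻¹) ^ j := by fun_prop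
      exact this.aestronglyMeasurable
  · refine hbd.mono' ?_ ?_
    · have : Measurable fun u : ℝ => ((u ^ (-δ) : ℝ) : ℂ) * ((1 - w₀ * u)⁻¹) ^ j := by fun_prop
      exact this.aestronglyMeasurable
    · refine (ae_restrict_iff' measurableSet_Ioc).2 (Filter.Eventually.of_forall fun u hu => ?_)
      have := Real.rpow_nonneg hu.1.le (-δ)
      rw [norm_mul, norm_pow, Complex.norm_real, Real.norm_of_nonneg this]
      gcongr
      exact hlow _ hw₀s u hu
  · have : Measurable fun u : ℝ => ((u ^ (-δ) : ℝ) : ℂ) *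
      (j * ((1 - w₀ * u)⁻¹) ^ (j - 1) * (u * ((1 - w₀ * u)⁻¹) ^ 2)) := by fun_prop
    exact this.aestronglyMeasurable
  · refine (ae_restrict_iff' measurableSet_Ioc).2 (Filter.Eventually.of_forall fun u hu w hw => ?_)
    have h1 := Real.rpow_nonneg hu.1.le (-δ)
    simp only [norm_mul, norm_pow, Complex.norm_real, Complex.norm_natCast,
      Real.norm_of_nonneg h1, Real.norm_of_nonneg hu.1.le]
    have h2 := hlow w hw u hu
    have h3 := hu.2
    have h4 := hu.1.le
    gcongr
  · exact hint.mul_const _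
  · refine (ae_restrict_iff' measurableSet_Ioc).2 (Filter.Eventually.of_forall fun u hu w hw => ?_)
    have hne : 1 - w * u ≠ 0 := by
      rw [← norm_pos_iff]
      exact hε0.trans_le (norm_one_sub_mul_ge hε1 (le_of_lt hw) hu)
    have h1 : HasDerivAt (fun w : ℂ => 1 - w * u) (-u) w := by
      simpa using ((hasDerivAt_id' w).mul_const (u : ℂ)).const_sub 1
    refine (((h1.fun_inv hne).fun_pow j).const_mul _).congr_deriv ?_
    rw [neg_neg, inv_pow, inv_pow, div_eq_mul_inv]

/-- Euler type integral for `₂F₁(K, -δ; 1 - δ; y)`. -/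
noncomputable def eulerIntegral (K : ℕ) (δ y : ℝ) : ℝ :=
  ∫ u in Set.Ioc (0 : ℝ) 1, u ^ (-δ - 1) * (1 - ((1 - y * u)⁻¹) ^ K)

theorem integrableOn_rpow_mul_inv_pow {δ y : ℝ} (hδ1 : δ < 1) (hy : y < 1) (j : ℕ) :
    IntegrableOn (fun u : ℝ => u ^ (-δ) * ((1 - y * u)⁻¹) ^ j) (Set.Ioc 0 1) := by
  set ε := min 1 (1 - y) with hε
  have hε0 : 0 < ε := lt_min one_pos (by linarith)
  have hbd : Integrable (fun u : ℝ => u ^ (-δ) * (ε⁻¹) ^ j) (volume.restrict (Set.Ioc 0 1)) :=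
    (integrableOn_rpow_Ioc (e := -δ) (by linarith)).mul_const _
  refine hbd.mono' (by fun_prop) ?_
  refine (ae_restrict_iff' measurableSet_Ioc).2 (Filter.Eventually.of_forall fun u hu => ?_)
  have h1 := Real.rpow_nonneg hu.1.le (-δ)
  have h2 : ε ≤ 1 - y * u := by
    have h3 : ε ≤ 1 := min_le_left _ _
    have h4 : ε ≤ 1 - y := min_le_right _ _
    nlinarith [hu.1, hu.2]
  rw [norm_mul, norm_pow, Real.norm_of_nonneg h1,
    Real.norm_of_nonneg (inv_nonneg.2 (hε0.le.trans h2))]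
  have h3 := inv_nonneg.2 (hε0.le.trans h2)
  gcongr

theorem integrableOn_eulerIntegral {δ y : ℝ} (K : ℕ) (hδ1 : δ < 1) (hy : y < 1) :
    IntegrableOn (fun u : ℝ => u ^ (-δ - 1) * (1 - ((1 - y * u)⁻¹) ^ K)) (Set.Ioc 0 1) := by
  refine IntegrableOn.congr_fun ?_ (fun u hu => (rpow_mul_one_sub_pow_eq K hy hu).symm)
    measurableSet_Ioc
  exact (integrable_finsetSum _ fun j _ => integrableOn_rpow_mul_inv_pow hδ1 hy _).const_mul _

theorem eulerIntegral_eq {δ y : ℝ} (K : ℕ) (hδ1 : δ < 1) (hy : y < 1) :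
    eulerIntegral K δ y = -y * ∑ j ∈ Finset.range K, (∫ u in Set.Ioc (0 : ℝ) 1,
      ((u ^ (-δ) : ℝ) : ℂ) * ((1 - (y : ℂ) * u)⁻¹) ^ (j + 1)).re := by
  rw [eulerIntegral, setIntegral_congr_fun measurableSet_Ioc
    (fun u hu => rpow_mul_one_sub_pow_eq K hy hu), integral_const_mul,
    integral_finsetSum _ fun j _ => integrableOn_rpow_mul_inv_pow hδ1 hy _]
  congr 1
  refine Finset.sum_congr rfl fun j _ => ?_
  rw [← Complex.ofReal_re (∫ u in Set.Ioc (0 : ℝ) 1, _), ← integral_complex_ofReal]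
  congr 2
  ext u
  push_cast
  rfl

theorem analyticOnNhd_eulerIntegral {δ : ℝ} (K : ℕ) (hδ1 : δ < 1) :
    AnalyticOnNhd ℝ (eulerIntegral K δ) (Set.Iio 1) := by
  have h : AnalyticOnNhd ℝ (fun y : ℝ => -y * ∑ j ∈ Finset.range K, (∫ u in Set.Ioc (0 : ℝ) 1,
      ((u ^ (-δ) : ℝ) : ℂ) * ((1 - (y : ℂ) * u)⁻¹) ^ (j + 1)).re) (Set.Iio 1) := by
    intro y hy
    refine analyticAt_id.neg.mul (Finset.analyticAt_fun_sum _ fun j _ => ?_)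
    have h1 := (differentiableOn_integral_rpow_mul_inv_pow hδ1 (j + 1)).analyticAt
      ((isOpen_lt Complex.continuous_re continuous_const).mem_nhds
        (show ((y : ℂ)).re < 1 from hy))
    exact h1.re_ofReal
  exact h.congr isOpen_Iio fun y hy => (eulerIntegral_eq K hδ1 hy).symm

/-- Expand (1 - yu)^{-(k+1)} in its binomial series and integrate termwise, with ∫ u^{n-δ} du = 1/(n
- δ + 1) on (0, 1]. -/
theorem hasSum_eulerIntegral {δ y : ℝ} (k : ℕ) (hδ0 : 0 < δ) (hδ1 : δ < 1) (hy : |y| < 1) :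
    HasSum (fun n : ℕ => ((n + k).choose k * (-δ / (n - δ))) * y ^ n)
      (1 + δ * eulerIntegral (k + 1) δ y) := by
  have hy1 : y < 1 := (le_abs_self y).trans_lt hy
  set c : ℕ → ℝ := fun n => ((n + 1 + k).choose k : ℝ) with hc
  have hexp : ∀ n : ℕ, (-1 : ℝ) < n - δ := fun n => by
    have : (0 : ℝ) ≤ n := n.cast_nonneg
    linarith
  have hI : ∀ n : ℕ, ∫ u in Set.Ioc (0 : ℝ) 1, u ^ ((n : ℝ) - δ) = (n - δ + 1)⁻¹ := fun n =>
    integral_rpow_Ioc (hexp n)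
  have hsum1 : Summable fun n : ℕ => c n * |y| ^ (n + 1) := by
    have := summable_choose_mul_geometric_of_norm_lt_one (R := ℝ) k (r := |y|) (by simpa using hy)
    exact (summable_nat_add_iff 1).2 this
  have hkey := hasSum_integral_of_summable_integral_norm
    (μ := volume.restrict (Set.Ioc (0 : ℝ) 1))
    (F := fun (n : ℕ) (u : ℝ) => -(c n * y ^ (n + 1)) * u ^ ((n : ℝ) - δ))
    (fun n => (integrableOn_rpow_Ioc (hexp n)).const_mul _) (by
      refine Summable.of_nonneg_of_le (fun n => by positivity) (fun n => ?_)
        (hsum1.mul_right (1 - δ)⁻¹)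
      have h1 : ∫ u in Set.Ioc (0 : ℝ) 1, ‖-(c n * y ^ (n + 1)) * u ^ ((n : ℝ) - δ)‖ =
          ∫ u in Set.Ioc (0 : ℝ) 1, c n * |y| ^ (n + 1) * u ^ ((n : ℝ) - δ) := by
        refine setIntegral_congr_fun measurableSet_Ioc fun u hu => ?_
        rw [norm_mul, Real.norm_of_nonneg (Real.rpow_nonneg hu.1.le _), norm_neg, norm_mul,
          norm_pow, Real.norm_eq_abs y, Real.norm_of_nonneg (by positivity)]
      rw [h1, integral_const_mul, hI]
      refine mul_le_mul_of_nonneg_left (inv_anti₀ (by linarith) ?_) (by positivity)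
      have : (0 : ℝ) ≤ n := n.cast_nonneg
      linarith)
  have hcongr : ∫ u in Set.Ioc (0 : ℝ) 1, ∑' n : ℕ, -(c n * y ^ (n + 1)) * u ^ ((n : ℝ) - δ) =
      eulerIntegral (k + 1) δ y := by
    refine setIntegral_congr_fun measurableSet_Ioc fun u hu => ?_
    have hyu : ‖y * u‖ < 1 := by
      rw [norm_mul, Real.norm_eq_abs, Real.norm_of_nonneg hu.1.le]
      nlinarith [hu.1, hu.2, abs_nonneg y]
    have h1 := hasSum_choose_mul_geometric_of_norm_lt_one k hyu
    -- The constant term of the series cancels the 1 in the integrand; hence the shift of `c` by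
    -- one.
    rw [← hasSum_nat_add_iff' 1] at h1
    have h2 := (h1.mul_left (-u ^ (-δ - 1)))
    refine HasSum.tsum_eq ?_
    convert! h2 using 1
    · ext n
      have h3 : u ^ ((n : ℝ) - δ) = u ^ (-δ - 1) * u ^ (n + 1) := by
        rw [← Real.rpow_natCast, ← Real.rpow_add hu.1]
        congr 1
        push_cast
        ring
      rw [h3, hc, mul_pow]
      ring
    · simp
      ring
  rw [hcongr] at hkey
  simp_rw [integral_const_mul, hI] at hkey
  rw [← hasSum_nat_add_iff' 1]
  have h0 : ∑ n ∈ Finset.range 1, ((n + k).choose k * (-δ / (n - δ))) * y ^ n = (1 : ℝ) := by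
    simp [hδ0.ne']
  rw [h0, add_sub_cancel_left]
  refine (hkey.mul_left δ).congr_fun fun n => ?_
  push_cast
  have := hexp n
  have h5 : (n : ℝ) - δ + 1 ≠ 0 := by linarith
  have h6 : (n : ℝ) + 1 - δ ≠ 0 := by linarith
  rw [hc]
  field_simp
  ring

/-- The analytic continuation of `₂F₁(K, -δ; 1 - δ; ·)` by an Euler type integral. -/
theorem hyp2F1_eq {δ y : ℝ} {K : ℕ} (hK : 1 ≤ K) (hδ0 : 0 < δ) (hδ1 : δ < 1) (hy : y < 1) :
    hyp2F1 K (-δ) (1 - δ) y = 1 + δ * eulerIntegral K δ y := by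
  obtain ⟨k, rfl⟩ := Nat.exists_eq_add_of_le' hK
  have hana : AnalyticOnNhd ℝ (fun y => 1 + δ * eulerIntegral (k + 1) δ y) (Set.Iio 1) :=
    fun y hy => analyticAt_const.add (analyticAt_const.mul
      (analyticOnNhd_eulerIntegral (k + 1) hδ1 y hy))
  have hser : ∀ y : ℝ, |y| < 1 → 1 + δ * eulerIntegral (k + 1) δ y =
      ordinaryHypergeometric ((k + 1 : ℕ) : ℝ) (-δ) (1 - δ) y := by
    intro y hy
    rw [ordinaryHypergeometric_eq_tsum, ← (hasSum_eulerIntegral k hδ0 hδ1 hy).tsum_eq]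
    simp_rw [hypergeometric_coeff hδ0 hδ1, smul_eq_mul]
  have hex : ∃ f : ℝ → ℝ, AnalyticOnNhd ℝ f (Set.Iio 1) ∧
      ∀ y : ℝ, |y| < 1 → f y = ordinaryHypergeometric ((k + 1 : ℕ) : ℝ) (-δ) (1 - δ) y :=
    ⟨_, hana, hser⟩
  rw [hyp2F1, dif_pos hex]
  -- Identity theorem: the chosen continuation and the Euler integral agree with the series near 0.
  refine hex.choose_spec.1.eqOn_of_preconnected_of_eventuallyEq hana isPreconnected_Iio
    (z₀ := 0) (by simp) ?_ hy
  filter_upwards [Metric.ball_mem_nhds (0 : ℝ) one_pos] with x hx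
  have hx' : |x| < 1 := by simpa using hx
  rw [hex.choose_spec.2 x hx', hser x hx']

/-! ### The interference exponent. -/

/-- The interference exponent in polar coordinates. -/
theorem integral_cluster {K : ℕ} (hK : 1 ≤ K) {α d₀ ρ Rc s : ℝ} (hα : 2 < α) (hd₀ : 0 < d₀)
    (hρ : 0 < ρ) (hRc : 0 ≤ Rc) (hs : 0 ≤ s) :
    IntegrableOn (fun r => r * (1 - ((1 + s * (ρ * pathLoss α d₀ r))⁻¹) ^ K)) (Set.Ioi Rc) ∧
    ∫ r in Set.Ioi Rc, r * (1 - ((1 + s * (ρ * pathLoss α d₀ r))⁻¹) ^ K) =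
      PsiII K α d₀ ρ Rc s - PsiI K α d₀ ρ Rc s := by
  have hα0 : 0 < α := by linarith
  set t₀ := 1 + Rc / d₀ with ht₀
  have ht0 : 0 < t₀ := by positivity
  set x := s * ρ * t₀ ^ (-α) with hx
  have hx0 : 0 ≤ x := by positivity
  -- Inverse of u = β(r)/β(R_c), which maps (R_c, ∞) onto (0, 1) and makes sρβ(r) = xu.
  set f : ℝ → ℝ := fun u => d₀ * (t₀ * u ^ (-(1 / α)) - 1) with hf
  set f' : ℝ → ℝ := fun u => d₀ * (t₀ * (-(1 / α) * u ^ (-(1 / α) - 1))) with hf'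
  have hderiv : ∀ u ∈ Set.Ioo (0 : ℝ) 1, HasDerivWithinAt f (f' u) (Set.Ioo 0 1) u := by
    intro u hu
    exact ((((Real.hasDerivAt_rpow_const (Or.inl hu.1.ne')).const_mul t₀).sub_const
      1).const_mul d₀).hasDerivWithinAt
  have hinv : ∀ u : ℝ, 0 < u → (u ^ (-(1 / α))) ^ (-α) = u := by
    intro u hu
    rw [← Real.rpow_mul hu.le]
    have : -(1 / α) * -α = 1 := by field_simp
    rw [this, Real.rpow_one]
  have hinj : Set.InjOn f (Set.Ioo 0 1) := by
    intro u hu v hv huv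
    have h1 : u ^ (-(1 / α)) = v ^ (-(1 / α)) := by
      have h2 := mul_left_cancel₀ hd₀.ne' huv
      exact mul_left_cancel₀ ht0.ne' (sub_left_injective h2)
    rw [← hinv u hu.1, h1, hinv v hv.1]
  have himage : f '' Set.Ioo 0 1 = Set.Ioi Rc := by
    have hRc' : d₀ * (t₀ - 1) = Rc := by
      rw [ht₀]
      field_simp
      ring
    ext r
    constructor
    · rintro ⟨u, hu, rfl⟩
      have h1 : 1 < u ^ (-(1 / α)) :=
        Real.one_lt_rpow_of_pos_of_lt_one_of_neg hu.1 hu.2 (by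
          have : 0 < 1 / α := by positivity
          linarith)
      rw [Set.mem_Ioi, ← hRc', hf]
      beta_reduce
      have h2 : t₀ < t₀ * u ^ (-(1 / α)) := lt_mul_of_one_lt_right ht0 h1
      exact mul_lt_mul_of_pos_left (by linarith) hd₀
    · intro hr
      have hr' : Rc < r := hr
      have h1 : 1 < (1 + r / d₀) / t₀ := by
        rw [one_lt_div ht0, ht₀]
        gcongr
      refine ⟨((1 + r / d₀) / t₀) ^ (-α), ⟨by positivity,
        Real.rpow_lt_one_of_one_lt_of_neg h1 (by linarith)⟩, ?_⟩
      rw [hf]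
      beta_reduce
      rw [← Real.rpow_mul (by positivity)]
      have : -α * -(1 / α) = 1 := by field_simp
      rw [this, Real.rpow_one]
      field_simp
      ring
  have hIoo : ∀ u ∈ Set.Ioo (0 : ℝ) 1,
      |f' u| • (f u * (1 - ((1 + s * (ρ * pathLoss α d₀ (f u)))⁻¹) ^ K)) =
        d₀ ^ 2 * t₀ ^ 2 / α * (u ^ (-(2 / α) - 1) * (1 - ((1 - (-x) * u)⁻¹) ^ K)) -
        d₀ ^ 2 * t₀ / α * (u ^ (-(1 / α) - 1) * (1 - ((1 - (-x) * u)⁻¹) ^ K)) := by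
    intro u hu
    have h1 : 1 + s * (ρ * pathLoss α d₀ (f u)) = 1 - (-x) * u := by
      have h2 : 1 + f u / d₀ = t₀ * u ^ (-(1 / α)) := by
        rw [hf]
        field_simp
        ring
      rw [pathLoss, h2, Real.mul_rpow ht0.le (Real.rpow_nonneg hu.1.le _), hinv u hu.1, hx]
      ring
    have h3 : |f' u| = d₀ * t₀ / α * u ^ (-(1 / α) - 1) := by
      have h4 : f' u = -(d₀ * t₀ / α * u ^ (-(1 / α) - 1)) := by
        rw [hf']
        field_simp
      have := Real.rpow_nonneg hu.1.le (-(1 / α) - 1)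
      rw [h4, abs_neg, abs_of_nonneg (by positivity)]
    -- The two terms of r = d₀(t₀u^{-1/α} - 1), times the Jacobian, give the exponents with δ = 2/α
    -- and δ = 1/α.
    have h5 : u ^ (-(2 / α) - 1) = u ^ (-(1 / α) - 1) * u ^ (-(1 / α)) := by
      rw [← Real.rpow_add hu.1]
      congr 1
      ring
    rw [h1, h3, h5, smul_eq_mul, hf]
    ring
  have hδ1 : 1 / α < 1 := by rw [div_lt_one hα0]; linarith
  have hδ2 : 2 / α < 1 := by rw [div_lt_one hα0]; linarith
  have hy : -x < 1 := by linarith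
  have hi1 := ((integrableOn_eulerIntegral K hδ1 hy).mono_set Set.Ioo_subset_Ioc_self)
  have hi2 := ((integrableOn_eulerIntegral K hδ2 hy).mono_set Set.Ioo_subset_Ioc_self)
  constructor
  · rw [← himage, integrableOn_image_iff_integrableOn_abs_deriv_smul measurableSet_Ioo hderiv hinj,
      integrableOn_congr_fun hIoo measurableSet_Ioo]
    exact (hi2.const_mul _).sub (hi1.const_mul _)
  · rw [← himage, integral_image_eq_integral_abs_deriv_smul measurableSet_Ioo hderiv hinj,
      setIntegral_congr_fun measurableSet_Ioo hIoo,
      integral_sub (hi2.const_mul _) (hi1.const_mul _), integral_const_mul, integral_const_mul,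
      ← integral_Ioc_eq_integral_Ioo, ← integral_Ioc_eq_integral_Ioo, PsiI, PsiII, ← ht₀, ← hx,
      hyp2F1_eq hK (by positivity) hδ1 hy, hyp2F1_eq hK (by positivity) hδ2 hy, eulerIntegral,
      eulerIntegral]
    field_simp
    ring

/-! ### Signal and interference of a single BS. -/

theorem pathLoss_nonneg {α d₀ r : ℝ} (hd₀ : 0 < d₀) (hr : 0 ≤ r) : 0 ≤ pathLoss α d₀ r := by
  unfold pathLoss
  positivity

theorem pathLoss_le_one {α d₀ r : ℝ} (hα : 0 ≤ α) (hd₀ : 0 < d₀) (hr : 0 ≤ r) :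
    pathLoss α d₀ r ≤ 1 := by
  have : 0 ≤ r / d₀ := by positivity
  exact Real.rpow_le_one_of_one_le_of_nonpos (by linarith) (by linarith)

theorem measurable_pathLoss {α d₀ : ℝ} : Measurable (pathLoss α d₀) := by
  unfold pathLoss
  fun_prop

open Classical in
/-- Minus the logarithm of the conditional Laplace transform at `s`, given the locations, of the
interference from a BS at `x`. -/
noncomputable def logLaplace (K : ℕ) (α d₀ ρ Rc s : ℝ) (x : Plane) : ENNReal :=
  if Rc < ‖x‖ then ENNReal.ofReal (K * Real.log (1 + s * (ρ * pathLoss α d₀ ‖x‖))) else 0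

theorem measurable_logLaplace {K : ℕ} {α d₀ ρ Rc s : ℝ} :
    Measurable (logLaplace K α d₀ ρ Rc s) := by
  classical
  unfold logLaplace
  refine Measurable.ite (measurableSet_lt measurable_const measurable_norm) ?_ measurable_const
  have := measurable_pathLoss (α := α) (d₀ := d₀)
  fun_prop

theorem expNeg_logLaplace {K : ℕ} {α d₀ ρ Rc s : ℝ} {x : Plane} (hd₀ : 0 < d₀) (hρ : 0 < ρ)
    (hs : 0 ≤ s) (hx : Rc < ‖x‖) :
    expNeg (logLaplace K α d₀ ρ Rc s x) =
      ENNReal.ofReal (((1 + s * (ρ * pathLoss α d₀ ‖x‖))⁻¹) ^ K) := by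
  have h1 : 0 ≤ s * (ρ * pathLoss α d₀ ‖x‖) :=
    mul_nonneg hs (mul_nonneg hρ.le (pathLoss_nonneg hd₀ (norm_nonneg x)))
  rw [logLaplace, if_pos hx, expNeg_ofReal (mul_nonneg K.cast_nonneg
    (Real.log_nonneg (by linarith))), Real.exp_neg, Real.exp_nat_mul, Real.exp_log (by linarith),
    inv_pow]

theorem expNeg_logLaplace_of_le {K : ℕ} {α d₀ ρ Rc s : ℝ} {x : Plane} (hx : ¬ Rc < ‖x‖) :
    expNeg (logLaplace K α d₀ ρ Rc s x) = 1 := by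
  rw [logLaplace, if_neg hx, expNeg_zero]

/-- Bernoulli's inequality and (1 + x)⁻¹ ≥ 1 - x. The left half supplies signs; the right half gives
the linear bound at z → 0 that offsets 1/z in the rate integral. -/
theorem one_sub_inv_pow_mem {x : ℝ} (hx : 0 ≤ x) (K : ℕ) :
    0 ≤ 1 - ((1 + x)⁻¹) ^ K ∧ 1 - ((1 + x)⁻¹) ^ K ≤ K * x := by
  have h1 : (1 + x)⁻¹ ≤ 1 := inv_le_one_of_one_le₀ (by linarith)
  have h0 : 0 ≤ (1 + x)⁻¹ := by positivity
  have h2 := one_add_mul_le_pow (a := (1 + x)⁻¹ - 1) (by linarith) K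
  have h3 : -x ≤ (1 + x)⁻¹ - 1 := by
    have : (1 + x)⁻¹ - 1 + x = x ^ 2 / (1 + x) := by
      field_simp
      ring
    have h4 : 0 ≤ x ^ 2 / (1 + x) := by positivity
    linarith
  have h5 : ((1 + x)⁻¹) ^ K ≤ 1 := pow_le_one₀ h0 h1
  have h6 : (K : ℝ) * -x ≤ K * ((1 + x)⁻¹ - 1) := mul_le_mul_of_nonneg_left h3 K.cast_nonneg
  rw [add_sub_cancel] at h2
  constructor <;> linarith

theorem lintegral_logLaplace {K : ℕ} (hK : 1 ≤ K) {lam α d₀ ρ Rc s : ℝ} (hlam : 0 < lam)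
    (hα : 2 < α) (hd₀ : 0 < d₀) (hρ : 0 < ρ) (hRc : 0 ≤ Rc) (hs : 0 ≤ s) :
    ∫⁻ x, (1 - expNeg (logLaplace K α d₀ ρ Rc s x))
      ∂(ENNReal.ofReal lam • (volume : Measure Plane)) =
      ENNReal.ofReal (2 * Real.pi * lam * (PsiII K α d₀ ρ Rc s - PsiI K α d₀ ρ Rc s)) := by
  obtain ⟨hint, hval⟩ := integral_cluster hK hα hd₀ hρ hRc hs
  set g : ℝ → ℝ := fun r => 1 - ((1 + s * (ρ * pathLoss α d₀ r))⁻¹) ^ K with hg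
  have hgnn : ∀ r, 0 ≤ r → 0 ≤ g r := fun r hr => (one_sub_inv_pow_mem
    (mul_nonneg hs (mul_nonneg hρ.le (pathLoss_nonneg hd₀ hr))) K).1
  have hpt : ∀ x : Plane, 1 - expNeg (logLaplace K α d₀ ρ Rc s x) =
      ENNReal.ofReal ((Set.Ioi Rc).indicator g ‖x‖) := by
    intro x
    by_cases hx : Rc < ‖x‖
    · rw [expNeg_logLaplace hd₀ hρ hs hx, Set.indicator_of_mem (by exact hx), hg,
        ENNReal.ofReal_sub _ (by
          have := pathLoss_nonneg (α := α) hd₀ (norm_nonneg x)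
          positivity), ENNReal.ofReal_one]
    · rw [expNeg_logLaplace_of_le hx, Set.indicator_of_notMem (by exact hx)]
      simp
  have hind : ∀ y : ℝ, y ^ (Module.finrank ℝ Plane - 1) • (Set.Ioi Rc).indicator g y =
      (Set.Ioi Rc).indicator (fun r => r * g r) y := by
    intro y
    have : Module.finrank ℝ Plane - 1 = 1 := by simp
    rw [this, pow_one, smul_eq_mul, Set.indicator_mul_right]
  have hset : Set.Ioi (0 : ℝ) ∩ Set.Ioi Rc = Set.Ioi Rc :=
    Set.inter_eq_right.2 (Set.Ioi_subset_Ioi hRc)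
  have hI : Integrable (fun x : Plane => (Set.Ioi Rc).indicator g ‖x‖) := by
    rw [integrable_fun_norm_addHaar (volume : Measure Plane)]
    simp_rw [hind]
    rw [integrableOn_indicator_iff measurableSet_Ioi, Set.inter_comm, hset]
    exact hint
  have hball : (volume : Measure Plane).real (Metric.ball 0 1) = Real.pi := by
    simp [Measure.real, EuclideanSpace.volume_ball_fin_two, Real.pi_nonneg]
  have hV := integral_fun_norm_addHaar (volume : Measure Plane) ((Set.Ioi Rc).indicator g)
  simp_rw [hind] at hV
  rw [setIntegral_indicator measurableSet_Ioi, hset, hval, hball, finrank_euclideanSpace,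
    Fintype.card_fin] at hV
  simp_rw [hpt]
  rw [lintegral_smul_measure, ← ofReal_integral_eq_lintegral_ofReal hI
    (Filter.Eventually.of_forall fun x => Set.indicator_nonneg
      (fun r hr => hgnn r (hRc.trans (le_of_lt hr))) _), hV, smul_eq_mul,
    ← ENNReal.ofReal_mul hlam.le]
  congr 1
  simp only [smul_eq_mul, nsmul_eq_mul]
  push_cast
  ring

theorem PsiI_le_PsiII {K : ℕ} (hK : 1 ≤ K) {α d₀ ρ Rc s : ℝ}
    (hα : 2 < α) (hd₀ : 0 < d₀) (hρ : 0 < ρ) (hRc : 0 ≤ Rc) (hs : 0 ≤ s) :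
    PsiI K α d₀ ρ Rc s ≤ PsiII K α d₀ ρ Rc s := by
  rw [← sub_nonneg, ← (integral_cluster hK hα hd₀ hρ hRc hs).2]
  refine setIntegral_nonneg measurableSet_Ioi fun r hr => ?_
  have hr0 : 0 ≤ r := hRc.trans (le_of_lt hr)
  exact mul_nonneg hr0 (one_sub_inv_pow_mem
    (mul_nonneg hs (mul_nonneg hρ.le (pathLoss_nonneg hd₀ hr0))) K).1

theorem lintegral_nearestLaw {lam : ℝ} (hlam : 0 < lam) {φ : ℝ → ℝ} (hφ : Measurable φ)
    (hφ0 : ∀ r, 0 < r → 0 ≤ φ r) (hφ1 : ∀ r, 0 < r → φ r ≤ 1) :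
    ∫⁻ t, ENNReal.ofReal (φ t) ∂nearestLaw lam =
      ENNReal.ofReal (∫ t in Set.Ioi 0, deriv (Frmin lam) t * φ t) := by
  have hd : deriv (Frmin lam) = fun t =>
      2 * lam * Real.pi * t * Real.exp (-(lam * Real.pi * t ^ 2)) := funext (deriv_Frmin lam)
  have hdm : Measurable (deriv (Frmin lam)) := measurable_deriv _
  have hd0 : ∀ t, 0 < t → 0 ≤ deriv (Frmin lam) t := by
    intro t ht
    have := Real.pi_pos
    rw [deriv_Frmin]
    positivity
  have hfin : ∫⁻ t in Set.Ioi 0, ENNReal.ofReal (deriv (Frmin lam) t) ≤ 1 := by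
    have h1 := nearestLaw_Ici hlam 0
    rw [nearestLaw, withDensity_apply _ measurableSet_Ici,
      Measure.restrict_restrict measurableSet_Ici,
      Set.inter_eq_right.2 Set.Ioi_subset_Ici_self] at h1
    rw [h1]
    simp
  have hInt : IntegrableOn (deriv (Frmin lam)) (Set.Ioi 0) := by
    refine ⟨hdm.aestronglyMeasurable, ?_⟩
    rw [hasFiniteIntegral_iff_ofReal ((ae_restrict_iff' measurableSet_Ioi).2
      (Filter.Eventually.of_forall hd0))]
    exact hfin.trans_lt ENNReal.one_lt_top
  rw [nearestLaw, lintegral_withDensity_eq_lintegral_mul _ hdm.ennreal_ofReal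
    hφ.ennreal_ofReal, ofReal_integral_eq_lintegral_ofReal]
  · refine setLIntegral_congr_fun measurableSet_Ioi fun t ht => ?_
    rw [Pi.mul_apply, ENNReal.ofReal_mul (hd0 t ht)]
  · refine Integrable.mono' hInt (hdm.mul hφ).aestronglyMeasurable ?_
    refine (ae_restrict_iff' measurableSet_Ioi).2 (Filter.Eventually.of_forall fun t ht => ?_)
    rw [norm_mul, Real.norm_of_nonneg (hd0 t ht), Real.norm_of_nonneg (hφ0 t ht)]
    exact mul_le_of_le_one_right (hd0 t ht) (hφ1 t ht)
  · exact (ae_restrict_iff' measurableSet_Ioi).2 (Filter.Eventually.of_forall fun t ht =>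
      mul_nonneg (hd0 t ht) (hφ0 t ht))

theorem ae_pos_nearestLaw (lam : ℝ) : ∀ᵐ t ∂nearestLaw lam, 0 < t := by
  refine (withDensity_absolutelyContinuous _ _).ae_le ?_
  exact ae_restrict_mem measurableSet_Ioi

theorem measurable_interferenceFrom {M K O : ℕ} {α d₀ ρ Rc : ℝ} :
    Measurable fun p : Plane × AntennaVec M × (Users K O → AntennaVec M) =>
      interferenceFrom α d₀ ρ Rc p.1 p.2.1 p.2.2 := by
  classical
  unfold interferenceFrom
  refine Measurable.ite (measurableSet_lt measurable_const (by fun_prop)) ?_ measurable_const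
  have h1 := measurable_pathLoss (α := α) (d₀ := d₀)
  refine Finset.measurable_sum _ fun k _ => ?_
  have h2 := measurable_zfBeam (M := M) (ι := Users K O) (Sum.inl k)
  have h3 : Measurable fun p : Plane × AntennaVec M × (Users K O → AntennaVec M) =>
      inner ℂ p.2.1 (zfBeam p.2.2 (Sum.inl k)) := by fun_prop
  fun_prop

theorem interferenceFrom_nonneg {M K O : ℕ} {α d₀ ρ Rc : ℝ} (hd₀ : 0 < d₀) (hρ : 0 < ρ)
    (x : Plane) (h : AntennaVec M) (c : Users K O → AntennaVec M) :
    0 ≤ interferenceFrom α d₀ ρ Rc x h c := by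
  unfold interferenceFrom
  split_ifs
  · have := pathLoss_nonneg (α := α) hd₀ (norm_nonneg x)
    positivity
  · exact le_rfl

theorem measurable_signalPower {M K O : ℕ} {α d₀ ρ : ℝ} (i : Fin K) :
    Measurable fun p : ℝ × (Users K O → AntennaVec M) => signalPower α d₀ ρ p.1 p.2 i := by
  unfold signalPower
  have h1 := measurable_pathLoss (α := α) (d₀ := d₀)
  have h2 := measurable_zfBeam (M := M) (ι := Users K O) (Sum.inl i)
  have h3 : Measurable fun p : ℝ × (Users K O → AntennaVec M) =>
      inner ℂ (p.2 (Sum.inl i)) (zfBeam p.2 (Sum.inl i)) := by fun_prop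
  fun_prop

theorem signalPower_nonneg {M K O : ℕ} {α d₀ ρ r : ℝ} (hd₀ : 0 < d₀) (hρ : 0 < ρ) (hr : 0 ≤ r)
    (g : Users K O → AntennaVec M) (i : Fin K) : 0 ≤ signalPower α d₀ ρ r g i := by
  unfold signalPower
  have := pathLoss_nonneg (α := α) hd₀ hr
  positivity

/-- The Laplace transform of the interference from a BS with orthonormal beams. -/
theorem lintegral_expNeg_interferenceFrom {M K O : ℕ} {α d₀ ρ Rc s : ℝ} (hd₀ : 0 < d₀)
    (hρ : 0 < ρ) (hs : 0 ≤ s) {x : Plane} {c : Users K O → AntennaVec M}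
    (hc : Rc < ‖x‖ → HasOrthogonalScheduledUsers c) :
    ∫⁻ h, expNeg (ENNReal.ofReal (s * interferenceFrom α d₀ ρ Rc x h c)) ∂complexGaussianVec M =
      expNeg (logLaplace K α d₀ ρ Rc s x) := by
  by_cases hx : Rc < ‖x‖
  · have hβ := pathLoss_nonneg (α := α) hd₀ (norm_nonneg x)
    have h0 : 0 ≤ s * (ρ * pathLoss α d₀ ‖x‖) := by positivity
    have h1 := integral_exp_neg_mul_sum_normSq_inner (orthonormal_zfBeam (hc hx)) h0
    rw [Fintype.card_fin] at h1
    rw [expNeg_logLaplace hd₀ hρ hs hx, ← h1, ofReal_integral_eq_lintegral_ofReal]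
    · congr 1
      ext h
      rw [expNeg_ofReal (mul_nonneg hs (interferenceFrom_nonneg hd₀ hρ _ _ _)), interferenceFrom,
        if_pos hx, ← Finset.mul_sum, mul_assoc s]
      simp_rw [norm_inner_symm h]
    · refine Integrable.of_bound (C := 1) (Continuous.aestronglyMeasurable (by fun_prop))
        (Filter.Eventually.of_forall fun h => ?_)
      rw [Real.norm_eq_abs, Real.abs_exp, Real.exp_le_one_iff, neg_nonpos]
      positivity
    · exact Filter.Eventually.of_forall fun h => (Real.exp_pos _).le
  · rw [expNeg_logLaplace_of_le hx]
    simp [interferenceFrom, hx, expNeg_zero]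

theorem lintegral_exp_neg_signalPower {M K O ζ : ℕ} {α d₀ ρ r z : ℝ} (hζ : 1 ≤ ζ)
    (hM : M + 1 = K + O + ζ) (hd₀ : 0 < d₀) (hρ : 0 < ρ) (hr : 0 ≤ r) (hz : 0 ≤ z) (i : Fin K) :
    ∫⁻ g, ENNReal.ofReal (Real.exp (-(z * signalPower α d₀ ρ r g i)))
      ∂(Measure.pi fun _ : Users K O => complexGaussianVec M) =
      ENNReal.ofReal (((1 + z * ρ * pathLoss α d₀ r)⁻¹) ^ ζ) := by
  have hβ := pathLoss_nonneg (α := α) hd₀ hr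
  have h1 := integral_exp_neg_mul_normSq_inner_zfBeam (M := M) (ζ := ζ) (ι := Users K O)
    (Sum.inl i) (by simpa using hM) hζ (s := z * ρ * pathLoss α d₀ r) (by positivity)
  rw [← h1, ofReal_integral_eq_lintegral_ofReal]
  · congr 1
    ext g
    rw [signalPower]
    congr 3
    ring
  · have h2 := measurable_zfBeam (M := M) (ι := Users K O) (Sum.inl i)
    have h3 : Measurable fun g : Users K O → AntennaVec M =>
        inner ℂ (g (Sum.inl i)) (zfBeam g (Sum.inl i)) := by fun_prop
    refine Integrable.of_bound (C := 1) (by fun_prop) (Filter.Eventually.of_forall fun h => ?_)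
    rw [Real.norm_eq_abs, Real.abs_exp, Real.exp_le_one_iff, neg_nonpos]
    positivity
  · exact Filter.Eventually.of_forall fun h => (Real.exp_pos _).le

/-- A Frullani integral. -/
theorem lintegral_frullani {a x : ℝ} (ha : 0 < a) (hx : 0 ≤ x) :
    ∫⁻ z in Set.Ioi (0 : ℝ), ENNReal.ofReal (Real.exp (-(z * a)) / z * (1 - Real.exp (-(z * x)))) =
      ENNReal.ofReal (Real.log (1 + x / a)) := by
  have hnn : ∀ z ∈ Set.Ioi (0 : ℝ), 0 ≤ Real.exp (-(z * a)) / z * (1 - Real.exp (-(z * x))) := by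
    intro z hz
    have hz' : 0 < z := hz
    have : Real.exp (-(z * x)) ≤ 1 := by
      rw [Real.exp_le_one_iff, neg_nonpos]
      positivity
    exact mul_nonneg (by positivity) (by linarith)
  have hint : IntegrableOn (fun z : ℝ => Real.exp (-(z * a)) / z * (1 - Real.exp (-(z * x))))
      (Set.Ioi 0) := by
    -- Domination from 1 - e^{-zx} ≤ zx, which cancels the 1/z.
    have h1 : IntegrableOn (fun z : ℝ => x * Real.exp (-a * z)) (Set.Ioi 0) :=
      (exp_neg_integrableOn_Ioi 0 ha).const_mul x
    refine Integrable.mono' h1 (by fun_prop) ?_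
    refine (ae_restrict_iff' measurableSet_Ioi).2 (Filter.Eventually.of_forall fun z hz => ?_)
    have hz' : 0 < z := hz
    rw [Real.norm_of_nonneg (hnn z hz)]
    have h2 := Real.add_one_le_exp (-(z * x))
    have h3 : Real.exp (-(z * a)) / z * (1 - Real.exp (-(z * x))) ≤
        Real.exp (-(z * a)) / z * (z * x) :=
      mul_le_mul_of_nonneg_left (by linarith) (by positivity)
    refine h3.trans (le_of_eq ?_)
    have h4 : -(z * a) = -a * z := by ring
    rw [h4]
    field_simp
  have heq : ∀ z ∈ Set.Ioi (0 : ℝ), Real.exp (-(z * a)) / z * (1 - Real.exp (-(z * x))) =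
      z⁻¹ • (Real.exp (-(a * z)) - Real.exp (-((a + x) * z))) := by
    intro z _
    have h5 : -((a + x) * z) = -(z * a) + -(z * x) := by ring
    rw [h5, Real.exp_add, smul_eq_mul, mul_comm a z]
    ring
  have hF := Frullani.integral_Ioi_eq (f := fun z : ℝ => Real.exp (-z)) (a := a) (b := a + x)
    (L := 1) (R := 0)
    ((Continuous.locallyIntegrable (f := fun z : ℝ => Real.exp (-z))
      (by fun_prop)).locallyIntegrableOn _) ha (by linarith)
    (by
      have : Filter.Tendsto (fun z : ℝ => Real.exp (-z)) (nhds 0) (nhds 1) := by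
        have hc : Continuous fun z : ℝ => Real.exp (-z) := by fun_prop
        simpa using hc.tendsto 0
      exact this.mono_left nhdsWithin_le_nhds)
    Real.tendsto_exp_neg_atTop_nhds_zero ((integrableOn_congr_fun heq measurableSet_Ioi).1 hint)
  rw [← ofReal_integral_eq_lintegral_ofReal hint
    ((ae_restrict_iff' measurableSet_Ioi).2 (Filter.Eventually.of_forall hnn)),
    setIntegral_congr_fun measurableSet_Ioi heq, hF, sub_zero, smul_eq_mul, mul_one, add_div,
    div_self ha.ne']

/-! ### Averaging over fading and locations. -/

section Rate

variable {Ω : Type*} [MeasurableSpace Ω] {P : Measure Ω}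

/-- Fubini on the product law: U may be averaged with V frozen, without conditional expectations. -/
theorem lintegral_comp_of_indepFun [IsProbabilityMeasure P] {𝓤 𝓥 : Type*}
    [MeasurableSpace 𝓤] [MeasurableSpace 𝓥]
    {U : Ω → 𝓤} {V : Ω → 𝓥} (hU : Measurable U) (hV : Measurable V) (hUV : IndepFun U V P)
    {F : 𝓤 × 𝓥 → ENNReal} (hF : Measurable F) :
    ∫⁻ ω, F (U ω, V ω) ∂P = ∫⁻ ω, ∫⁻ u, F (u, V ω) ∂(P.map U) ∂P := by
  have hmap := (indepFun_iff_map_prod_eq_prod_map_map hU.aemeasurable hV.aemeasurable).1 hUV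
  have := Measure.isProbabilityMeasure_map (μ := P) hU.aemeasurable
  have := Measure.isProbabilityMeasure_map (μ := P) hV.aemeasurable
  rw [← lintegral_map (f := F) hF (hU.prodMk hV), hmap, lintegral_prod_symm _ hF.aemeasurable,
    lintegral_map hF.lintegral_prod_left' hV]

theorem Measurable.expNeg_interferenceFrom {β : Type*} [MeasurableSpace β] {M K O : ℕ}
    {α d₀ ρ Rc : ℝ} (s : ℝ) {x : β → Plane} {h : β → AntennaVec M}
    {c : β → Users K O → AntennaVec M} (hx : Measurable x) (hh : Measurable h)
    (hc : Measurable c) :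
    Measurable fun a => expNeg (ENNReal.ofReal
      (s * interferenceFrom α d₀ ρ Rc (x a) (h a) (c a))) := by
  have h1 : Measurable fun a => interferenceFrom α d₀ ρ Rc (x a) (h a) (c a) :=
    measurable_interferenceFrom.comp (f := fun a => (x a, h a, c a)) (hx.prodMk (hh.prodMk hc))
  exact measurable_expNeg.comp (h1.const_mul s).ennreal_ofReal

theorem Measurable.exp_neg_signalPower {β : Type*} [MeasurableSpace β] {M K O : ℕ}
    {α d₀ ρ : ℝ} (z : ℝ) (i : Fin K) {r : β → ℝ} {g : β → Users K O → AntennaVec M}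
    (hr : Measurable r) (hg : Measurable g) :
    Measurable fun a => ENNReal.ofReal
      (Real.exp (-(z * signalPower α d₀ ρ (r a) (g a) i))) := by
  have h1 : Measurable fun a => signalPower α d₀ ρ (r a) (g a) i :=
    (measurable_signalPower i).comp (f := fun a => (r a, g a)) (hr.prodMk hg)
  exact (h1.const_mul z).neg.exp.ennreal_ofReal

theorem lintegral_prod_expNeg_interference {M K O : ℕ} {α d₀ ρ Rc s : ℝ} (hd₀ : 0 < d₀)
    (hρ : 0 < ρ) (hs : 0 ≤ s) {H : ℕ → Ω → AntennaVec M} (hH : ∀ n, Measurable (H n))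
    (hH_law : ∀ n, P.map (H n) = complexGaussianVec M) (hH_iid : iIndepFun H P) (x : ℕ → Plane)
    (c : ℕ → Users K O → AntennaVec M)
    (horth : ∀ n, Rc < ‖x n‖ → HasOrthogonalScheduledUsers (c n)) (N : ℕ) :
    ∫⁻ ω, ∏ n ∈ Finset.range N,
      expNeg (ENNReal.ofReal (s * interferenceFrom α d₀ ρ Rc (x n) (H n ω) (c n))) ∂P =
      ∏ n ∈ Finset.range N, expNeg (logLaplace K α d₀ ρ Rc s (x n)) := by
  have hone : ∀ n, Measurable fun h : AntennaVec M => expNeg (ENNReal.ofReal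
      (s * interferenceFrom α d₀ ρ Rc (x n) h (c n))) := fun n =>
    Measurable.expNeg_interferenceFrom s measurable_const measurable_id measurable_const
  rw [lintegral_prod_eq_prod_lintegral_of_indepFun (Finset.range N)
    (fun n ω' => expNeg (ENNReal.ofReal (s * interferenceFrom α d₀ ρ Rc (x n) (H n ω') (c n))))
    (hH_iid.comp _ hone) fun n => (hone n).comp (hH n)]
  refine Finset.prod_congr rfl fun n _ => ?_
  rw [← lintegral_map (hone n) (hH n), hH_law,
    lintegral_expNeg_interferenceFrom hd₀ hρ hs (horth n)]

/-- Averaging over the fading vectors of the interfering BSs, all else being fixed. -/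
theorem lintegral_expNeg_interference [IsProbabilityMeasure P] {M K O : ℕ}
    {α d₀ ρ Rc s : ℝ} (hd₀ : 0 < d₀) (hρ : 0 < ρ) (hs : 0 ≤ s)
    {H : ℕ → Ω → AntennaVec M} (hH : ∀ n, Measurable (H n))
    (hH_law : ∀ n, P.map (H n) = complexGaussianVec M) (hH_iid : iIndepFun H P)
    {𝓥 : Type*} [MeasurableSpace 𝓥] {V : Ω → 𝓥} (hV : Measurable V)
    (hHV : IndepFun (fun ω n => H n ω) V P) {x : ℕ → 𝓥 → Plane} (hx : ∀ n, Measurable (x n))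
    {c : ℕ → 𝓥 → Users K O → AntennaVec M} (hc : ∀ n, Measurable (c n))
    (horth : ∀ᵐ ω ∂P, ∀ n, Rc < ‖x n (V ω)‖ → HasOrthogonalScheduledUsers (c n (V ω)))
    {ψ : 𝓥 → ENNReal} (hψ : Measurable ψ) (hψ1 : ∀ᵐ ω ∂P, ψ (V ω) ≤ 1) :
    ∫⁻ ω, expNeg (∑' n, ENNReal.ofReal
      (s * interferenceFrom α d₀ ρ Rc (x n (V ω)) (H n ω) (c n (V ω)))) * ψ (V ω) ∂P =
      ∫⁻ ω, expNeg (∑' n, logLaplace K α d₀ ρ Rc s (x n (V ω))) * ψ (V ω) ∂P := by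
  have hI : ∀ n, Measurable fun p : (ℕ → AntennaVec M) × 𝓥 => expNeg (ENNReal.ofReal
      (s * interferenceFrom α d₀ ρ Rc (x n p.2) (p.1 n) (c n p.2))) := fun n =>
    Measurable.expNeg_interferenceFrom s ((hx n).comp measurable_snd)
      ((measurable_pi_apply n).comp measurable_fst) ((hc n).comp measurable_snd)
  have hHm : Measurable fun ω n => H n ω := measurable_pi_lambda _ hH
  have hL : ∀ n, Measurable fun ω => expNeg (logLaplace K α d₀ ρ Rc s (x n (V ω))) := fun n =>
    measurable_expNeg.comp (measurable_logLaplace.comp ((hx n).comp hV))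
  -- Independence factors only finite products, so the sum over BSs is truncated at N and recovered
  -- by dominated convergence, every factor being at most 1.
  have hfin : ∀ N : ℕ, ∫⁻ ω, (∏ n ∈ Finset.range N, expNeg (ENNReal.ofReal
      (s * interferenceFrom α d₀ ρ Rc (x n (V ω)) (H n ω) (c n (V ω))))) * ψ (V ω) ∂P =
      ∫⁻ ω, (∏ n ∈ Finset.range N, expNeg (logLaplace K α d₀ ρ Rc s (x n (V ω)))) *
        ψ (V ω) ∂P := by
    intro N
    have hF : Measurable fun p : (ℕ → AntennaVec M) × 𝓥 =>
        (∏ n ∈ Finset.range N, expNeg (ENNReal.ofReal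
          (s * interferenceFrom α d₀ ρ Rc (x n p.2) (p.1 n) (c n p.2)))) * ψ p.2 :=
      (Finset.measurable_prod _ fun n _ => hI n).mul (hψ.comp measurable_snd)
    rw [lintegral_comp_of_indepFun hHm hV hHV hF]
    refine lintegral_congr_ae ?_
    filter_upwards [horth] with ω hω
    have hprod : Measurable fun h : ℕ → AntennaVec M => ∏ n ∈ Finset.range N,
        expNeg (ENNReal.ofReal (s * interferenceFrom α d₀ ρ Rc (x n (V ω)) (h n) (c n (V ω)))) :=
      Finset.measurable_prod _ fun n _ => Measurable.expNeg_interferenceFrom s measurable_const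
        (measurable_pi_apply n) measurable_const
    rw [lintegral_mul_const _ hprod, lintegral_map hprod hHm]
    congr 1
    exact lintegral_prod_expNeg_interference hd₀ hρ hs hH hH_law hH_iid _ _ hω N
  have hlimit : ∀ (a : ℕ → Ω → ENNReal), (∀ n, Measurable fun ω => expNeg (a n ω)) →
      Filter.Tendsto (fun N => ∫⁻ ω, (∏ n ∈ Finset.range N, expNeg (a n ω)) * ψ (V ω) ∂P)
        Filter.atTop (nhds (∫⁻ ω, expNeg (∑' n, a n ω) * ψ (V ω) ∂P)) := by
    intro a ha
    refine tendsto_lintegral_of_dominated_convergence (fun _ => 1)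
      (fun N => (Finset.measurable_prod _ fun n _ => ha n).mul (hψ.comp hV)) (fun N => ?_)
      (by simp) ?_
    · filter_upwards [hψ1] with ω hω
      exact mul_le_one' (Finset.prod_le_one' fun n _ => expNeg_le_one _) hω
    · filter_upwards [hψ1] with ω hω
      exact ENNReal.Tendsto.mul_const (tendsto_prod_expNeg _)
        (Or.inr (ne_top_of_le_ne_top ENNReal.one_ne_top hω))
  have h1 := hlimit (fun n ω => ENNReal.ofReal
    (s * interferenceFrom α d₀ ρ Rc (x n (V ω)) (H n ω) (c n (V ω)))) fun n =>
      Measurable.expNeg_interferenceFrom s ((hx n).comp hV) (hH n) ((hc n).comp hV)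
  have h2 := hlimit (fun n ω => logLaplace K α d₀ ρ Rc s (x n (V ω))) hL
  simp_rw [hfin] at h1
  exact tendsto_nhds_unique h1 h2

/-- The serving distance is assumed independent of the outside process only, not of all locations.
As BSs in the cluster contribute 0, the sum factors through that process. -/
theorem tsum_logLaplace_eq {Ω : Type*} {K : ℕ} {α d₀ ρ Rc s : ℝ} (X : ℕ → Ω → Plane) (ω : Ω) :
    ∑' n, logLaplace K α d₀ ρ Rc s (X n ω) =
      ∫⁻ x, logLaplace K α d₀ ρ Rc s x ∂(outsideProcess X Rc ω) := by
  rw [outsideProcess, ← lintegral_indicator Metric.isClosed_closedBall.measurableSet.compl,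
    ← lintegral_countingMeasure X ω measurable_logLaplace]
  congr 1
  ext x
  by_cases hx : Rc < ‖x‖
  · rw [Set.indicator_of_mem (by simpa using hx)]
  · rw [Set.indicator_of_notMem (by simpa using hx), logLaplace, if_neg hx]

/-- Averaging over the fading vectors of the serving BS, all else being fixed. -/
theorem lintegral_mul_exp_neg_signalPower [IsProbabilityMeasure P] {M K O ζ : ℕ} (hζ : 1 ≤ ζ)
    (hM : M + 1 = K + O + ζ) {α d₀ ρ z : ℝ} (hd₀ : 0 < d₀) (hρ : 0 < ρ) (hz : 0 ≤ z)
    {r : Ω → ℝ} (hr : Measurable r) (hr_pos : ∀ᵐ ω ∂P, 0 < r ω)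
    {X : ℕ → Ω → Plane} (hX : ∀ n, Measurable (X n))
    (i : Fin K) {G : Users K O → Ω → AntennaVec M}
    (hG : ∀ l, Measurable (G l)) (hG_law : ∀ l, P.map (G l) = complexGaussianVec M)
    (hG_iid : iIndepFun G P)
    (hG_indep : IndepFun (fun ω l => G l ω) (fun ω => (r ω, fun n => X n ω)) P)
    {E : (ℕ → Plane) → ENNReal} (hE : Measurable E) :
    ∫⁻ ω, E (fun n => X n ω) *
      ENNReal.ofReal (Real.exp (-(z * signalPower α d₀ ρ (r ω) (fun l => G l ω) i))) ∂P =
      ∫⁻ ω, E (fun n => X n ω) *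
        ENNReal.ofReal (((1 + z * ρ * pathLoss α d₀ (r ω))⁻¹) ^ ζ) ∂P := by
  have hXm : Measurable fun ω n => X n ω := measurable_pi_lambda _ hX
  have hGm : Measurable fun ω l => G l ω := measurable_pi_lambda _ hG
  have hGpi : P.map (fun ω l => G l ω) = Measure.pi fun _ : Users K O => complexGaussianVec M := by
    rw [(iIndepFun_iff_map_fun_eq_pi_map fun l => (hG l).aemeasurable).1 hG_iid]
    simp_rw [hG_law]
  have hF : Measurable fun p : (Users K O → AntennaVec M) × ℝ × (ℕ → Plane) =>
      E p.2.2 * ENNReal.ofReal (Real.exp (-(z * signalPower α d₀ ρ p.2.1 p.1 i))) :=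
    (hE.comp (measurable_snd.comp measurable_snd)).mul
      (Measurable.exp_neg_signalPower z i (measurable_fst.comp measurable_snd) measurable_fst)
  rw [lintegral_comp_of_indepFun hGm (hr.prodMk hXm) hG_indep hF, hGpi]
  refine lintegral_congr_ae ?_
  filter_upwards [hr_pos] with ω hω
  rw [lintegral_const_mul _ (Measurable.exp_neg_signalPower z i measurable_const measurable_id'),
    lintegral_exp_neg_signalPower hζ hM hd₀ hρ hω.le hz]

/-- The Laplace transform of the interference, jointly with the distance to the serving BS. -/
theorem lintegral_expNeg_logLaplace_mul {K ζ : ℕ} (hK : 1 ≤ K) {lam α d₀ ρ Rc s z : ℝ}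
    [IsProbabilityMeasure P] (hlam : 0 < lam) (hα : 2 < α) (hd₀ : 0 < d₀) (hρ : 0 < ρ)
    (hRc : 0 ≤ Rc) (hs : 0 ≤ s) (hz : 0 ≤ z)
    {X : ℕ → Ω → Plane} (hX : IsHomogeneousPPP P X lam)
    {r : Ω → ℝ} (hr : Measurable r) (hr_map : P.map r = nearestLaw lam)
    (hr_indep : IndepFun r (outsideProcess X Rc) P) :
    ∫⁻ ω, expNeg (∑' n, logLaplace K α d₀ ρ Rc s (X n ω)) *
        ENNReal.ofReal (((1 + z * ρ * pathLoss α d₀ (r ω))⁻¹) ^ ζ) ∂P =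
      ENNReal.ofReal (Real.exp
        (2 * Real.pi * lam * (PsiI K α d₀ ρ Rc s - PsiII K α d₀ ρ Rc s))) *
      ENNReal.ofReal (∫ t in Set.Ioi (0 : ℝ),
        deriv (Frmin lam) t * ((1 + z * ρ * pathLoss α d₀ t)⁻¹) ^ ζ) := by
  set φ : ℝ → ℝ := fun t => ((1 + z * ρ * pathLoss α d₀ t)⁻¹) ^ ζ with hφ
  have hφm : Measurable φ := by
    have := measurable_pathLoss (α := α) (d₀ := d₀)
    rw [hφ]
    fun_prop
  have hEm : Measurable fun ω => expNeg (∑' n, logLaplace K α d₀ ρ Rc s (X n ω)) :=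
    measurable_expNeg.comp
      (Measurable.tsum fun n => measurable_logLaplace.comp (hX.measurable n))
  have hind : IndepFun (fun ω => expNeg (∑' n, logLaplace K α d₀ ρ Rc s (X n ω)))
      (fun ω => ENNReal.ofReal (φ (r ω))) P := by
    simp_rw [tsum_logLaplace_eq]
    exact hr_indep.symm.comp (measurable_expNeg.comp
      (Measure.measurable_lintegral measurable_logLaplace)) hφm.ennreal_ofReal
  have hmul := lintegral_mul_eq_lintegral_mul_lintegral_of_indepFun hEm
    (hφm.ennreal_ofReal.comp hr) hind
  refine hmul.trans ?_
  have hβ : ∀ t, 0 < t → 0 ≤ z * ρ * pathLoss α d₀ t := fun t ht =>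
    mul_nonneg (mul_nonneg hz hρ.le) (pathLoss_nonneg hd₀ ht.le)
  congr 1
  -- Viewing the scalar as an `NNReal` makes σ-finiteness available by instance search.
  · have : SigmaFinite (ENNReal.ofReal lam • (volume : Measure Plane)) :=
      inferInstanceAs (SigmaFinite (lam.toNNReal • (volume : Measure Plane)))
    have h4 := hX.lintegral_expNeg_lintegral
      (measurable_logLaplace (K := K) (α := α) (d₀ := d₀) (ρ := ρ) (Rc := Rc) (s := s))
    rw [lintegral_logLaplace hK hlam hα hd₀ hρ hRc hs, expNeg_ofReal (by
      have := sub_nonneg.2 (PsiI_le_PsiII hK hα hd₀ hρ hRc hs)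
      positivity)] at h4
    simp_rw [lintegral_countingMeasure X _ measurable_logLaplace] at h4
    refine h4.trans ?_
    congr 2
    ring
  · have h5 := lintegral_map (μ := P) hφm.ennreal_ofReal hr
    rw [hr_map, lintegral_nearestLaw hlam hφm (fun t ht => by have := hβ t ht; positivity)
      (fun t ht => by
        have := one_sub_inv_pow_mem (hβ t ht) ζ
        linarith [this.1])] at h5
    exact h5.symm

/-- The joint Laplace transform of the interference and the useful signal. -/
theorem lintegral_expNeg_interference_mul_signal [IsProbabilityMeasure P] {M K O ζ : ℕ}
    (hζ : 1 ≤ ζ) (hM : M + 1 = K + O + ζ) {lam α d₀ ρ Rc s z : ℝ} (hlam : 0 < lam) (hα : 2 < α)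
    (hd₀ : 0 < d₀) (hρ : 0 < ρ) (hRc : 0 ≤ Rc) (hs : 0 ≤ s) (hz : 0 ≤ z)
    {X : ℕ → Ω → Plane} (hX : IsHomogeneousPPP P X lam)
    {r : Ω → ℝ} (hr : Measurable r) (hr_map : P.map r = nearestLaw lam)
    (hr_indep : IndepFun r (outsideProcess X Rc) P)
    (i : Fin K) {G : Users K O → Ω → AntennaVec M}
    (hG : ∀ l, Measurable (G l)) (hG_law : ∀ l, P.map (G l) = complexGaussianVec M)
    (hG_iid : iIndepFun G P)
    (hG_indep : IndepFun (fun ω l => G l ω) (fun ω => (r ω, fun n => X n ω)) P)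
    {C : ℕ → Users K O → Ω → AntennaVec M} (hC : ∀ n l, Measurable (C n l))
    (hC_orth : ∀ᵐ ω ∂P, ∀ n, Rc < ‖X n ω‖ → HasOrthogonalScheduledUsers fun l => C n l ω)
    {H : ℕ → Ω → AntennaVec M}
    (hH : ∀ n, Measurable (H n)) (hH_law : ∀ n, P.map (H n) = complexGaussianVec M)
    (hH_iid : iIndepFun H P)
    (hH_indep : IndepFun (fun ω n => H n ω)
      (fun ω => (r ω, (fun n => X n ω), (fun l => G l ω), fun n l => C n l ω)) P) :
    ∫⁻ ω, expNeg (∑' n, ENNReal.ofReal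
      (s * interferenceFrom α d₀ ρ Rc (X n ω) (H n ω) (fun l => C n l ω))) *
        ENNReal.ofReal (Real.exp (-(z * signalPower α d₀ ρ (r ω) (fun l => G l ω) i))) ∂P =
      ENNReal.ofReal (Real.exp
        (2 * Real.pi * lam * (PsiI K α d₀ ρ Rc s - PsiII K α d₀ ρ Rc s))) *
      ENNReal.ofReal (∫ t in Set.Ioi (0 : ℝ),
        deriv (Frmin lam) t * ((1 + z * ρ * pathLoss α d₀ t)⁻¹) ^ ζ) := by
  have hXm : Measurable fun ω n => X n ω := measurable_pi_lambda _ hX.measurable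
  have hGm : Measurable fun ω l => G l ω := measurable_pi_lambda _ hG
  have hCm : Measurable fun ω n l => C n l ω :=
    measurable_pi_lambda _ fun n => measurable_pi_lambda _ (hC n)
  have hr_pos : ∀ᵐ ω ∂P, 0 < r ω :=
    ae_of_ae_map hr.aemeasurable (hr_map ▸ ae_pos_nearestLaw lam)
  have hψm : Measurable fun v : ℝ × (ℕ → Plane) × (Users K O → AntennaVec M) ×
      (ℕ → Users K O → AntennaVec M) =>
        ENNReal.ofReal (Real.exp (-(z * signalPower α d₀ ρ v.1 v.2.2.1 i))) :=
    Measurable.exp_neg_signalPower z i measurable_fst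
      (measurable_fst.comp (measurable_snd.comp measurable_snd))
  have hxm : ∀ n, Measurable fun v : ℝ × (ℕ → Plane) × (Users K O → AntennaVec M) ×
      (ℕ → Users K O → AntennaVec M) => v.2.1 n := fun n =>
    (measurable_pi_apply n).comp (measurable_fst.comp measurable_snd)
  have hcm : ∀ n, Measurable fun v : ℝ × (ℕ → Plane) × (Users K O → AntennaVec M) ×
      (ℕ → Users K O → AntennaVec M) => v.2.2.2 n := fun n =>
    (measurable_pi_apply n).comp (measurable_snd.comp (measurable_snd.comp measurable_snd))
  refine (lintegral_expNeg_interference (α := α) hd₀ hρ hs hH hH_law hH_iid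
    (hr.prodMk (hXm.prodMk (hGm.prodMk hCm))) hH_indep hxm hcm hC_orth hψm ?_).trans ?_
  · filter_upwards [hr_pos] with ω hω
    rw [ENNReal.ofReal_le_one, Real.exp_le_one_iff, neg_nonpos]
    exact mul_nonneg hz (signalPower_nonneg hd₀ hρ hω.le _ _)
  have hEm : Measurable fun x : ℕ → Plane => expNeg (∑' n, logLaplace K α d₀ ρ Rc s (x n)) :=
    measurable_expNeg.comp
      (Measurable.tsum fun n => measurable_logLaplace.comp (measurable_pi_apply n))
  exact (lintegral_mul_exp_neg_signalPower hζ hM hd₀ hρ hz hr hr_pos hX.measurable i hG hG_law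
    hG_iid hG_indep hEm).trans (lintegral_expNeg_logLaplace_mul (Nat.one_le_of_lt i.2) hlam hα hd₀
      hρ hRc hs hz hX hr hr_map hr_indep)

/-! ### From Laplace transforms to the mean rate. -/

/-- The mean rate in terms of the joint Laplace transform of signal and interference. -/
theorem ergodicRate_of_laplace [IsProbabilityMeasure P] {Y : ℕ → Ω → ℝ} {S : Ω → ℝ}
    (hY : ∀ n, Measurable (Y n)) (hY0 : ∀ n ω, 0 ≤ Y n ω) (hS : Measurable S)
    (hS0 : ∀ᵐ ω ∂P, 0 ≤ S ω) {A q : ℝ → ℝ} {s : ℕ → ℝ} {κ τ : ℝ} (hτ : 0 < τ)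
    (hlap : ∀ s z, 0 ≤ s → 0 ≤ z → ∫⁻ ω, expNeg (∑' n, ENNReal.ofReal (s * Y n ω)) *
      ENNReal.ofReal (Real.exp (-(z * S ω))) ∂P = ENNReal.ofReal (A s) * ENNReal.ofReal (q z))
    (hA0 : ∀ s, 0 ≤ A s) (hA1 : ∀ s, 0 ≤ s → A s ≤ 1) (hs : ∀ n, 0 < s n)
    (hAs : Filter.Tendsto (fun n => A (s n)) Filter.atTop (nhds 1))
    (hq0 : q 0 = 1) (hqnn : ∀ z, 0 ≤ z → 0 ≤ q z) (hq1 : ∀ z, 0 ≤ z → q z ≤ 1)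
    (hqκ : ∀ z, 0 ≤ z → 1 - q z ≤ κ * z) :
    (∀ᵐ ω ∂P, Summable fun n => Y n ω) ∧
    Integrable (fun ω => Real.log (1 + S ω / ((∑' n, Y n ω) + 1) / τ)) P ∧
    IntegrableOn (fun z => Real.exp (-(z * τ)) / z * A (z * τ) * (1 - q z)) (Set.Ioi 0) ∧
    ∫ ω, Real.log (1 + S ω / ((∑' n, Y n ω) + 1) / τ) ∂P =
      ∫ z in Set.Ioi 0, Real.exp (-(z * τ)) / z * A (z * τ) * (1 - q z) := by
  have hlapA : ∀ s, 0 ≤ s →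
      ∫⁻ ω, expNeg (∑' n, ENNReal.ofReal (s * Y n ω)) ∂P = ENNReal.ofReal (A s) := by
    intro s hs
    have := hlap s 0 hs le_rfl
    simpa [hq0] using this
  have hexpm : ∀ s, Measurable fun ω => expNeg (∑' n, ENNReal.ofReal (s * Y n ω)) := fun s =>
    measurable_expNeg.comp (Measurable.tsum fun n => ((hY n).const_mul s).ennreal_ofReal)
  -- finiteness of the interference
  have hIm : Measurable fun ω => ∑' n, ENNReal.ofReal (Y n ω) :=
    Measurable.tsum fun n => (hY n).ennreal_ofReal
  have hfin : ∀ᵐ ω ∂P, ∑' n, ENNReal.ofReal (Y n ω) ≠ ⊤ := by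
    have hms : MeasurableSet {ω | ∑' n, ENNReal.ofReal (Y n ω) ≠ ⊤} :=
      (hIm (measurableSet_singleton ⊤)).compl
    -- For s > 0, e^{-sI} is at most 1 and vanishes where I = ∞, so A(s) ≤ P(I < ∞).
    have hle : ∀ n, ENNReal.ofReal (A (s n)) ≤ P {ω | ∑' n, ENNReal.ofReal (Y n ω) ≠ ⊤} := by
      intro n
      rw [← hlapA _ (hs n).le, ← lintegral_indicator_one hms]
      refine lintegral_mono fun ω => ?_
      by_cases hω : ∑' n, ENNReal.ofReal (Y n ω) = ⊤
      · simp_rw [ENNReal.ofReal_mul (hs n).le, ENNReal.tsum_mul_left]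
        rw [hω, ENNReal.mul_top (ENNReal.ofReal_pos.2 (hs n)).ne', expNeg_top]
        exact zero_le
      · rw [Set.indicator_of_mem (by exact hω)]
        exact expNeg_le_one _
    have h1 : 1 ≤ P {ω | ∑' n, ENNReal.ofReal (Y n ω) ≠ ⊤} := by
      have h2 := (ENNReal.continuous_ofReal.tendsto 1).comp hAs
      rw [ENNReal.ofReal_one] at h2
      exact le_of_tendsto' h2 hle
    have h3 := (prob_compl_eq_zero_iff hms).2 (le_antisymm prob_le_one h1)
    exact h3
  have hsummable : ∀ᵐ ω ∂P, Summable fun n => Y n ω := by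
    filter_upwards [hfin] with ω hω
    refine (ENNReal.summable_toReal hω).congr fun n => ?_
    rw [ENNReal.toReal_ofReal (hY0 n ω)]
  -- The Frullani integrand for a = τ(1 + I) and x = S, with values in [0, ∞] so that Tonelli
  -- applies without prior integrability.
  set T : Ω → ℝ → ENNReal := fun ω z => ENNReal.ofReal (Real.exp (-(z * τ)) / z) *
    (expNeg (∑' n, ENNReal.ofReal (z * τ * Y n ω)) * ENNReal.ofReal (1 - Real.exp (-(z * S ω))))
    with hT
  have hTm : Measurable (Function.uncurry T) := by
    rw [Function.uncurry_def]
    have h1 : Measurable fun p : Ω × ℝ =>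
        expNeg (∑' n, ENNReal.ofReal (p.2 * τ * Y n p.1)) :=
      measurable_expNeg.comp (Measurable.tsum fun n => by fun_prop)
    have h2 : Measurable fun p : Ω × ℝ => ENNReal.ofReal (1 - Real.exp (-(p.2 * S p.1))) := by
      fun_prop
    have h3 : Measurable fun p : Ω × ℝ => ENNReal.ofReal (Real.exp (-(p.2 * τ)) / p.2) := by
      fun_prop
    exact h3.mul (h1.mul h2)
  set f : Ω → ℝ := fun ω => Real.log (1 + S ω / ((∑' n, Y n ω) + 1) / τ) with hf
  set g : ℝ → ℝ := fun z => Real.exp (-(z * τ)) / z * A (z * τ) * (1 - q z) with hg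
  have hTω : ∀ᵐ ω ∂P, ∫⁻ z in Set.Ioi 0, T ω z = ENNReal.ofReal (f ω) := by
    filter_upwards [hsummable, hS0] with ω hω hSω
    have hI0 : 0 ≤ ∑' n, Y n ω := tsum_nonneg fun n => hY0 n ω
    have h1 : S ω / ((∑' n, Y n ω) + 1) / τ = S ω / (τ * ((∑' n, Y n ω) + 1)) := by
      rw [div_div, mul_comm τ]
    rw [hf]
    beta_reduce
    rw [h1, ← lintegral_frullani (by positivity) hSω]
    refine setLIntegral_congr_fun measurableSet_Ioi fun z hz => ?_
    have hz' : 0 < z := hz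
    have h2 : ∑' n, ENNReal.ofReal (z * τ * Y n ω) =
        ENNReal.ofReal (z * τ * ∑' n, Y n ω) := by
      rw [← tsum_mul_left, ENNReal.ofReal_tsum_of_nonneg (fun n => by
        have := hY0 n ω
        positivity) (hω.mul_left _)]
    rw [hT]
    beta_reduce
    rw [h2, expNeg_ofReal (by positivity), ← mul_assoc, ← ENNReal.ofReal_mul (by positivity),
      ← ENNReal.ofReal_mul (by positivity)]
    congr 2
    have h3 : -(z * (τ * ((∑' n, Y n ω) + 1))) = -(z * τ) + -(z * τ * ∑' n, Y n ω) := by ring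
    rw [h3, Real.exp_add]
    ring
  have hTz : ∀ z ∈ Set.Ioi (0 : ℝ), ∫⁻ ω, T ω z ∂P = ENNReal.ofReal (g z) := by
    intro z hz
    have hz' : 0 < z := hz
    have hSm : Measurable fun ω => ENNReal.ofReal (Real.exp (-(z * S ω))) := by fun_prop
    have h1 : ∀ ω, expNeg (∑' n, ENNReal.ofReal (z * τ * Y n ω)) *
        ENNReal.ofReal (1 - Real.exp (-(z * S ω))) =
        expNeg (∑' n, ENNReal.ofReal (z * τ * Y n ω)) -
        expNeg (∑' n, ENNReal.ofReal (z * τ * Y n ω)) *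
          ENNReal.ofReal (Real.exp (-(z * S ω))) := by
      intro ω
      rw [ENNReal.ofReal_sub _ (Real.exp_pos _).le, ENNReal.mul_sub fun _ _ =>
        ne_top_of_le_ne_top ENNReal.one_ne_top (expNeg_le_one _), ENNReal.ofReal_one, mul_one]
    have h2 : ∫⁻ ω, expNeg (∑' n, ENNReal.ofReal (z * τ * Y n ω)) *
        ENNReal.ofReal (1 - Real.exp (-(z * S ω))) ∂P =
        ENNReal.ofReal (A (z * τ)) * ENNReal.ofReal (1 - q z) := by
      have h3 : Measurable fun ω => expNeg (∑' n, ENNReal.ofReal (z * τ * Y n ω)) *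
          ENNReal.ofReal (Real.exp (-(z * S ω))) := (hexpm _).mul hSm
      simp_rw [h1]
      rw [lintegral_sub h3, hlap _ _ (by positivity) hz'.le,
        hlapA _ (by positivity), ENNReal.ofReal_sub _ (hqnn z hz'.le), ENNReal.mul_sub fun _ _ =>
        ENNReal.ofReal_ne_top, ENNReal.ofReal_one, mul_one]
      · rw [hlap _ _ (by positivity) hz'.le]
        exact ENNReal.mul_ne_top ENNReal.ofReal_ne_top ENNReal.ofReal_ne_top
      · filter_upwards [hS0] with ω hω
        refine mul_le_of_le_one_right' ?_
        rw [ENNReal.ofReal_le_one, Real.exp_le_one_iff, neg_nonpos]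
        positivity
    have h3 : Measurable fun ω => expNeg (∑' n, ENNReal.ofReal (z * τ * Y n ω)) *
        ENNReal.ofReal (1 - Real.exp (-(z * S ω))) := (hexpm _).mul (by fun_prop)
    rw [hT]
    beta_reduce
    rw [lintegral_const_mul _ h3, h2, ← mul_assoc,
      ← ENNReal.ofReal_mul (by positivity), ← ENNReal.ofReal_mul (mul_nonneg (by positivity)
      (hA0 _))]
  have hg0 : ∀ z ∈ Set.Ioi (0 : ℝ), 0 ≤ g z := by
    intro z hz
    have hz' : 0 < z := hz
    exact mul_nonneg (mul_nonneg (by positivity) (hA0 _)) (sub_nonneg.2 (hq1 z hz'.le))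
  -- No measurability of A or q is assumed: on (0, ∞), g is the partial integral of the jointly
  -- measurable T.
  have hgm : AEStronglyMeasurable g (volume.restrict (Set.Ioi 0)) := by
    have h1 : Measurable fun z => (∫⁻ ω, T ω z ∂P).toReal :=
      (hTm.lintegral_prod_left').ennreal_toReal
    refine h1.aestronglyMeasurable.congr ((ae_restrict_iff' measurableSet_Ioi).2
      (Filter.Eventually.of_forall fun z hz => ?_))
    beta_reduce
    rw [hTz z hz, ENNReal.toReal_ofReal (hg0 z hz)]
  have hgint : IntegrableOn g (Set.Ioi 0) := by
    have h1 : IntegrableOn (fun z : ℝ => κ * Real.exp (-τ * z)) (Set.Ioi 0) :=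
      (exp_neg_integrableOn_Ioi 0 hτ).const_mul κ
    refine Integrable.mono' h1 hgm ?_
    refine (ae_restrict_iff' measurableSet_Ioi).2 (Filter.Eventually.of_forall fun z hz => ?_)
    have hz' : 0 < z := hz
    rw [Real.norm_of_nonneg (hg0 z hz)]
    have h2 : Real.exp (-(z * τ)) / z * A (z * τ) ≤ Real.exp (-(z * τ)) / z :=
      mul_le_of_le_one_right (by positivity) (hA1 _ (by positivity))
    have h3 : g z ≤ Real.exp (-(z * τ)) / z * (κ * z) :=
      mul_le_mul h2 (hqκ z hz'.le) (sub_nonneg.2 (hq1 z hz'.le)) (by positivity)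
    refine h3.trans (le_of_eq ?_)
    have h4 : -(z * τ) = -τ * z := by ring
    rw [h4]
    field_simp
  have hkey : ∫⁻ ω, ENNReal.ofReal (f ω) ∂P = ENNReal.ofReal (∫ z in Set.Ioi 0, g z) := by
    rw [ofReal_integral_eq_lintegral_ofReal hgint
      ((ae_restrict_iff' measurableSet_Ioi).2 (Filter.Eventually.of_forall hg0)),
      ← setLIntegral_congr_fun measurableSet_Ioi hTz, ← lintegral_congr_ae hTω,
      lintegral_lintegral_swap hTm.aemeasurable]
  have hf0 : 0 ≤ᵐ[P] f := by
    filter_upwards [hS0] with ω hω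
    have hI0 : 0 ≤ ∑' n, Y n ω := tsum_nonneg fun n => hY0 n ω
    exact Real.log_nonneg (by
      have : 0 ≤ S ω / ((∑' n, Y n ω) + 1) / τ := by positivity
      linarith)
  -- The real sum agrees almost everywhere with the extended sum, which is measurable without
  -- summability.
  have hfm : AEStronglyMeasurable f P := by
    have h1 : Measurable fun ω => Real.log
        (1 + S ω / ((∑' n, ENNReal.ofReal (Y n ω)).toReal + 1) / τ) := by fun_prop
    refine h1.aestronglyMeasurable.congr ?_
    filter_upwards [hsummable] with ω hω
    rw [← ENNReal.ofReal_tsum_of_nonneg (fun n => hY0 n ω) hω,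
      ENNReal.toReal_ofReal (tsum_nonneg fun n => hY0 n ω)]
  refine ⟨hsummable, ⟨hfm, ?_⟩, hgint, ?_⟩
  · rw [hasFiniteIntegral_iff_ofReal hf0, hkey]
    exact ENNReal.ofReal_lt_top
  · rw [integral_eq_lintegral_of_nonneg_ae hf0 hfm, hkey, ENNReal.toReal_ofReal
      (setIntegral_nonneg measurableSet_Ioi hg0)]

/-- Dominated convergence in the radial integral, the integrand at s = 1 being the bound. This
yields A → 1, hence finite interference. -/
theorem tendsto_PsiII_sub_PsiI {K : ℕ} (hK : 1 ≤ K) {α d₀ ρ Rc : ℝ}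
    (hα : 2 < α) (hd₀ : 0 < d₀) (hρ : 0 < ρ) (hRc : 0 ≤ Rc) :
    Filter.Tendsto (fun n : ℕ => PsiII K α d₀ ρ Rc (1 / ((n : ℝ) + 1)) -
      PsiI K α d₀ ρ Rc (1 / ((n : ℝ) + 1))) Filter.atTop (nhds 0) := by
  have hs : ∀ n : ℕ, 0 ≤ 1 / ((n : ℝ) + 1) := fun n => by positivity
  have hs1 : ∀ n : ℕ, 1 / ((n : ℝ) + 1) ≤ 1 := fun n => by
    rw [div_le_one (by positivity)]
    have : (0 : ℝ) ≤ n := n.cast_nonneg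
    linarith
  simp_rw [fun n : ℕ => (integral_cluster hK hα hd₀ hρ hRc (hs n)).2.symm]
  have hlim := tendsto_integral_of_dominated_convergence
    (μ := volume.restrict (Set.Ioi Rc)) (f := fun _ => (0 : ℝ))
    (F := fun (n : ℕ) r =>
      r * (1 - ((1 + 1 / ((n : ℝ) + 1) * (ρ * pathLoss α d₀ r))⁻¹) ^ K))
    (fun r => r * (1 - ((1 + 1 * (ρ * pathLoss α d₀ r))⁻¹) ^ K))
    (fun n => (integral_cluster hK hα hd₀ hρ hRc (hs n)).1.aestronglyMeasurable)
    (integral_cluster hK hα hd₀ hρ hRc zero_le_one).1 (fun n => ?_) ?_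
  · simpa using hlim
  · refine (ae_restrict_iff' measurableSet_Ioi).2 (Filter.Eventually.of_forall fun r hr => ?_)
    have hr0 : 0 ≤ r := hRc.trans (le_of_lt hr)
    have hβ := mul_nonneg hρ.le (pathLoss_nonneg (α := α) hd₀ hr0)
    have hx : 0 ≤ 1 / ((n : ℝ) + 1) * (ρ * pathLoss α d₀ r) := mul_nonneg (hs n) hβ
    rw [Real.norm_of_nonneg (mul_nonneg hr0 (one_sub_inv_pow_mem hx K).1)]
    have := hs1 n
    gcongr
  · refine (ae_restrict_iff' measurableSet_Ioi).2 (Filter.Eventually.of_forall fun r _ => ?_)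
    have h1 : Filter.Tendsto (fun n : ℕ => 1 + 1 / ((n : ℝ) + 1) * (ρ * pathLoss α d₀ r))
        Filter.atTop (nhds 1) := by
      simpa using (tendsto_one_div_add_atTop_nhds_zero_nat.mul_const
        (ρ * pathLoss α d₀ r)).const_add (1 : ℝ)
    have h2 := (((h1.inv₀ one_ne_zero).pow K).const_sub 1).const_mul r
    simpa using h2

/-- F' is a probability density on (0, ∞), so pointwise bounds survive averaging. -/
theorem integral_deriv_Frmin_mul_bounds {lam : ℝ} (hlam : 0 < lam) {φ : ℝ → ℝ}
    (hφ : Measurable φ) {c : ℝ}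
    (hφ0 : ∀ r, 0 < r → 0 ≤ φ r) (hφ1 : ∀ r, 0 < r → φ r ≤ 1) (hφc : ∀ r, 0 < r → c ≤ φ r) :
    0 ≤ ∫ t in Set.Ioi 0, deriv (Frmin lam) t * φ t ∧
    ∫ t in Set.Ioi 0, deriv (Frmin lam) t * φ t ≤ 1 ∧
    c ≤ ∫ t in Set.Ioi 0, deriv (Frmin lam) t * φ t := by
  have hnn : 0 ≤ ∫ t in Set.Ioi 0, deriv (Frmin lam) t * φ t := by
    refine setIntegral_nonneg measurableSet_Ioi fun t ht => mul_nonneg ?_ (hφ0 t ht)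
    have ht' : 0 < t := ht
    have := Real.pi_pos
    rw [deriv_Frmin]
    positivity
  have huniv : nearestLaw lam Set.univ = 1 := by
    have h1 := nearestLaw_Ici hlam 0
    have h2 : nearestLaw lam (Set.Iio 0) = 0 := by
      rw [← Set.compl_Ici, measure_eq_zero_iff_ae_notMem]
      filter_upwards [ae_pos_nearestLaw lam] with t ht hn
      exact hn ht.le
    rw [← Set.Iio_union_Ici (a := (0 : ℝ)), measure_union
      (Set.Iio_disjoint_Ici le_rfl) measurableSet_Ici, h1, h2]
    simp
  have h := lintegral_nearestLaw hlam hφ hφ0 hφ1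
  refine ⟨hnn, ?_, ?_⟩
  · rw [← ENNReal.ofReal_le_one, ← h]
    calc ∫⁻ t, ENNReal.ofReal (φ t) ∂nearestLaw lam ≤ ∫⁻ _, 1 ∂nearestLaw lam := by
          refine lintegral_mono_ae ?_
          filter_upwards [ae_pos_nearestLaw lam] with t ht
          exact ENNReal.ofReal_le_one.2 (hφ1 t ht)
      _ = 1 := by rw [lintegral_one, huniv]
  · rw [← ENNReal.ofReal_le_ofReal_iff hnn, ← h]
    calc ENNReal.ofReal c = ∫⁻ _, ENNReal.ofReal c ∂nearestLaw lam := by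
          rw [lintegral_const, huniv, mul_one]
      _ ≤ _ := by
          refine lintegral_mono_ae ?_
          filter_upwards [ae_pos_nearestLaw lam] with t ht
          exact ENNReal.ofReal_le_ofReal (hφc t ht)

end Rate

/-! ### The rate formula. -/

theorem theorem2
    -- antennas, scheduled users, nulled users per BS, and the diversity order
    (M K O ζ : ℕ) (hζ : 1 ≤ ζ) (hM : M + 1 = K + O + ζ)
    -- BS density, path-loss exponent, reference distance, per-user SNR, SNR gap, cluster radius
    (lam α d₀ ρ τ Rc : ℝ) (hlam : 0 < lam) (hα : 2 < α) (hd₀ : 0 < d₀) (hρ : 0 < ρ) (hτ : 0 < τ)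
    (hRc : 0 ≤ Rc)
    {Ω : Type*} [MeasurableSpace Ω] (P : Measure Ω) [IsProbabilityMeasure P]
    -- locations of the BSs, relative to the user
    (X : ℕ → Ω → Plane) (hX : IsHomogeneousPPP P X lam)
    -- distance to the serving BS: distributed as the distance to the closest BS, and independent
    -- of the BSs outside the cluster
    (r : Ω → ℝ) (hr : Measurable r) (hr_law : IdentDistrib r (nearestDistance X) P P)
    (hr_indep : IndepFun r (outsideProcess X Rc) P)
    -- the typical user is the scheduled user `i` of its BS; `G` is the small-scale fading between
    -- this BS and the users it handles
    (i : Fin K) (G : Users K O → Ω → AntennaVec M)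
    (hG : ∀ l, Measurable (G l)) (hG_law : ∀ l, P.map (G l) = complexGaussianVec M)
    (hG_iid : iIndepFun G P)
    (hG_indep : IndepFun (fun ω l => G l ω) (fun ω => (r ω, fun n => X n ω)) P)
    -- channels from the other BSs to the users they handle
    (C : ℕ → Users K O → Ω → AntennaVec M) (hC : ∀ n l, Measurable (C n l))
    (hC_orth : ∀ᵐ ω ∂P, ∀ n, Rc < ‖X n ω‖ → HasOrthogonalScheduledUsers fun l => C n l ω)
    -- small-scale fading from the other BSs to the typical user
    (H : ℕ → Ω → AntennaVec M)
    (hH : ∀ n, Measurable (H n)) (hH_law : ∀ n, P.map (H n) = complexGaussianVec M)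
    (hH_iid : iIndepFun H P)
    (hH_indep : IndepFun (fun ω n => H n ω)
      (fun ω => (r ω, (fun n => X n ω), (fun l => G l ω), fun n l => C n l ω)) P) :
    -- the interference is almost surely finite, the rate has finite mean, the integral converges
    (∀ᵐ ω ∂P, Summable fun n =>
      interferenceFrom α d₀ ρ Rc (X n ω) (H n ω) (fun l => C n l ω)) ∧
    Integrable (fun ω => Real.log (1 + sinr α d₀ ρ Rc (r ω) (fun l => G l ω) i
      (fun n => X n ω) (fun n => H n ω) (fun n l => C n l ω) / τ)) P ∧
    IntegrableOn (rateIntegrand K ζ lam α d₀ ρ τ Rc) (Set.Ioi 0) ∧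
    -- the per-BS ergodic sum rate, in nats
    (K : ℝ) * ∫ ω, Real.log (1 + sinr α d₀ ρ Rc (r ω) (fun l => G l ω) i
      (fun n => X n ω) (fun n => H n ω) (fun n l => C n l ω) / τ) ∂P =
    (K : ℝ) * ∫ z in Set.Ioi (0 : ℝ), rateIntegrand K ζ lam α d₀ ρ τ Rc z := by
  have hK : 1 ≤ K := Nat.one_le_of_lt i.2
  have hr_map : P.map r = nearestLaw lam := by
    rw [hr_law.map_eq, map_nearestDistance hlam hX]
  have hr_pos : ∀ᵐ ω ∂P, 0 < r ω :=
    ae_of_ae_map hr.aemeasurable (hr_map ▸ ae_pos_nearestLaw lam)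
  have hpi := Real.pi_pos
  set A : ℝ → ℝ := fun s => Real.exp
    (2 * Real.pi * lam * (PsiI K α d₀ ρ Rc s - PsiII K α d₀ ρ Rc s)) with hA
  set q : ℝ → ℝ := fun z => ∫ t in Set.Ioi (0 : ℝ),
    deriv (Frmin lam) t * ((1 + z * ρ * pathLoss α d₀ t)⁻¹) ^ ζ with hq
  have hφm : ∀ z, Measurable fun t => ((1 + z * ρ * pathLoss α d₀ t)⁻¹) ^ ζ := fun z => by
    have := measurable_pathLoss (α := α) (d₀ := d₀)
    fun_prop
  have hβ : ∀ z, 0 ≤ z → ∀ t, 0 < t → 0 ≤ z * ρ * pathLoss α d₀ t := fun z hz t ht =>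
    mul_nonneg (mul_nonneg hz hρ.le) (pathLoss_nonneg hd₀ ht.le)
  have hbounds : ∀ z, 0 ≤ z → 0 ≤ q z ∧ q z ≤ 1 ∧ 1 - ζ * ρ * z ≤ q z := by
    intro z hz
    refine integral_deriv_Frmin_mul_bounds hlam (hφm z)
      (fun t ht => ?_) (fun t ht => ?_) fun t ht => ?_
    · have := hβ z hz t ht
      positivity
    · linarith [(one_sub_inv_pow_mem (hβ z hz t ht) ζ).1]
    · have h1 := (one_sub_inv_pow_mem (hβ z hz t ht) ζ).2
      -- As β ≤ 1, the linear bound is uniform in the distance; this is the source of κ = ζρ.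
      have h2 : (ζ : ℝ) * (z * ρ * pathLoss α d₀ t) ≤ ζ * (z * ρ) :=
        mul_le_mul_of_nonneg_left (mul_le_of_le_one_right (by positivity)
          (pathLoss_le_one (by linarith) hd₀ ht.le)) ζ.cast_nonneg
      linarith
  have hA1 : ∀ s, 0 ≤ s → A s ≤ 1 := by
    intro s hs
    rw [hA, Real.exp_le_one_iff]
    exact mul_nonpos_of_nonneg_of_nonpos (by positivity)
      (sub_nonpos.2 (PsiI_le_PsiII hK hα hd₀ hρ hRc hs))
  have hAs : Filter.Tendsto (fun n : ℕ => A (1 / ((n : ℝ) + 1))) Filter.atTop (nhds 1) := by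
    have h1 := (tendsto_PsiII_sub_PsiI hK hα hd₀ hρ hRc).const_mul (-(2 * Real.pi * lam))
    have h2 := (Real.continuous_exp.tendsto _).comp h1
    rw [mul_zero, Real.exp_zero] at h2
    refine h2.congr fun n => ?_
    simp only [hA, Function.comp_apply]
    congr 1
    ring
  -- The upper and lower bounds on q coincide at z = 0.
  have hq0 : q 0 = 1 := by
    have h1 := (hbounds 0 le_rfl).2.1
    have h2 := (hbounds 0 le_rfl).2.2
    rw [mul_zero, sub_zero] at h2
    exact le_antisymm h1 h2
  have hYm : ∀ n, Measurable fun ω =>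
      interferenceFrom α d₀ ρ Rc (X n ω) (H n ω) (fun l => C n l ω) := fun n =>
    measurable_interferenceFrom.comp (f := fun ω => (X n ω, H n ω, fun l => C n l ω))
      ((hX.measurable n).prodMk ((hH n).prodMk (measurable_pi_lambda _ (hC n))))
  have hSm : Measurable fun ω => signalPower α d₀ ρ (r ω) (fun l => G l ω) i :=
    (measurable_signalPower i).comp (f := fun ω => (r ω, fun l => G l ω))
      (hr.prodMk (measurable_pi_lambda _ hG))
  obtain ⟨h1, h2, h3, h4⟩ := ergodicRate_of_laplace (P := P) (κ := ζ * ρ) (τ := τ) (A := A)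
    (q := q) (s := fun n : ℕ => 1 / ((n : ℝ) + 1)) hYm
    (fun n ω => interferenceFrom_nonneg hd₀ hρ _ _ _) hSm
    (by
      filter_upwards [hr_pos] with ω hω
      exact signalPower_nonneg hd₀ hρ hω.le _ _) hτ
    (fun s z hs hz => lintegral_expNeg_interference_mul_signal hζ hM hlam hα hd₀ hρ hRc hs hz hX hr
      hr_map hr_indep i hG hG_law hG_iid hG_indep hC hC_orth hH hH_law hH_iid hH_indep)
    (fun s => (Real.exp_pos _).le) hA1 (fun n => by positivity) hAs hq0
    (fun z hz => (hbounds z hz).1) (fun z hz => (hbounds z hz).2.1)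
    (fun z hz => by linarith [(hbounds z hz).2.2])
  have hrate : rateIntegrand K ζ lam α d₀ ρ τ Rc =
      fun z => Real.exp (-(z * τ)) / z * A (z * τ) * (1 - q z) := by
    funext z
    rw [rateIntegrand, hA, hq]
    simp_rw [zpow_neg, zpow_natCast, inv_pow]
    rfl
  rw [hrate]
  exact ⟨h1, h2, h3, by rw [← h4]; rfl⟩
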